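/- Let $\Omega$ be a compact metric space with its Borel $\sigma$-algebra and a probability measure $\mathbf P$, and let $\tau_y:\Omega\to\Omega$, $y\in\mathbb R^d$, be an ergodic measure preserving dynamical system: $\tau_0=\mathrm{Id}$, $\tau_{y_1+y_2}=\tau_{y_1}\circ\tau_{y_2}$, $\mathbf P(\tau_y(Q))=\mathbf P(Q)$ for all measurable $Q$, the map $(\omega,y)\mapsto\tau_y\omega$ is measurable and continuous, and every measurable function invariant under $\tau$ is a.s. constant. Let $\mathbf M$ be the space of symmetric $d\times d$ real matrices with $\xi\cdot\eta=(\xi,\eta)=\sum_{i,j}\xi_{ij}\eta_{ij}$ and $|\xi|=(\xi\cdot\xi)^{1/2}$. Let $p:\Omega\to\mathbb R$ be measurable with $1<\alpha\le p(\omega)\le\beta<\infty$ for a.e. $\omega$, where $\alpha,\beta$ are constants, and put $p'(\omega)=p(\omega)/(p(\omega)-1)$. Let $\mathbf A:\Omega\times\mathbf M\to\mathbf M$ satisfy: * **h1.** $\mathbf A(\omega,\cdot)$ is continuous for a.e. $\omega$, and $\mathbf A(\cdot,\xi)$ is measurable for every $\xi\in\mathbf M$; * **h2.** for a.e. $\omega$,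 $(\mathbf A(\omega,\xi_1)-\mathbf A(\omega,\xi_2),\xi_1-\xi_2)>0$ for all $\xi_1\neq\xi_2$; * **h3.** there is $c_0>0$ such that for a.e. $\omega$, $(\mathbf A(\omega,\xi),\xi)\ge c_0|\xi|^{p(\omega)}-c_0^{-1}$ for all $\xi$; * **h4.** there is $c_1>0$ such that for a.e. $\omega$, $|\mathbf A(\omega,\xi)|^{p'(\omega)}\le c_1|\xi|^{p(\omega)}+c_1$ for all $\xi$. Let $L^{p(\cdot)}(\Omega;\mathbf M)$ be the space of (a.e. classes of) measurable $v:\Omega\to\mathbf M$ with $\int_\Omega|v|^{p(\omega)}\,d\mathbf P<\infty$, with the Luxemburg norm $\|v\|=\inf\{\lambda>0:\int_\Omega|\lambda^{-1}v|^{p(\omega)}\,d\mathbf P\le1\}$. Let $\partial_i$ be the generator in $L^2(\Omega)$ of the group $f\mapsto f\circ\tau_{he_i}$, $h\in\mathbb R$, and let $\mathcal D^\infty$ be the set of $f\in L^\infty(\Omega)$ for which all iterated derivatives $\partial_{i_1}\cdots\partial_{i_k}f$ exist in $L^2(\Omega)$. Let $\mathcal G(\Omega)$ be the closure in $L^{p(\cdot)}(\Omega;\mathbf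 M)$ of $$\{D_\omega\varphi:\ \varphi\in(\mathcal D^\infty)^d,\ \partial_1\varphi_1+\dots+\partial_d\varphi_d=0\},\qquad (D_\omega\varphi)_{ij}=\tfrac12(\partial_i\varphi_j+\partial_j\varphi_i).$$ Then for every $\xi\in\mathbf M$ the function $\mathbf A(\omega,\xi+v(\omega))\cdot\theta(\omega)$ is integrable for all $v,\theta\in\mathcal G(\Omega)$, and there is a unique $v_\xi\in\mathcal G(\Omega)$ (up to a.e. equality) such that $$\int_\Omega\mathbf A(\omega,\xi+v_\xi(\omega))\cdot\theta(\omega)\,d\mathbf P(\omega)=0\qquad\text{for all }\theta\in\mathcal G(\Omega).$$ -/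

import Mathlib

open MeasureTheory Filter Topology
open scoped ENNReal

noncomputable section

namespace StochasticCell

/-- Symmetric `d × d` real matrices, as a subspace of the `d × d` arrays with the Frobenius
inner product `ξ · η = ∑ i j, ξ i j * η i j`. -/
def symSubmodule (d : ℕ) : Submodule ℝ (EuclideanSpace ℝ (Fin d × Fin d)) where
  carrier := {ξ | ∀ i j, ξ (i, j) = ξ (j, i)}
  add_mem' := by
    intro a b ha hb i j
    simp [ha i j, hb i j]
  zero_mem' := by
    intro i j
    simp
  smul_mem' := by
    intro c a ha i j
    simp [ha i j]

/-- The space `M` of symmetric `d × d` matrices, with the Frobenius inner product and norm. -/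
abbrev SymMat (d : ℕ) : Type := symSubmodule d

/-- The entry `ξ i j` of a symmetric matrix. -/
def SymMat.entry {d : ℕ} (ξ : SymMat d) (i j : Fin d) : ℝ :=
  (ξ : EuclideanSpace ℝ (Fin d × Fin d)) (i, j)

/-- An ergodic, continuous, measure preserving `d`-dimensional dynamical system
`τ y : Ω → Ω`, `y ∈ ℝᵈ`, on a topological probability space. -/
structure IsErgodicSystem {Ω : Type*} [TopologicalSpace Ω] [MeasurableSpace Ω] {d : ℕ}
    (P : Measure Ω) (τ : EuclideanSpace ℝ (Fin d) → Ω → Ω) : Prop where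
  zero : τ 0 = id
  add : ∀ y₁ y₂, τ (y₁ + y₂) = τ y₁ ∘ τ y₂
  measure_image : ∀ y (Q : Set Ω), MeasurableSet Q → P (τ y '' Q) = P Q
  measurable : Measurable (fun q : Ω × EuclideanSpace ℝ (Fin d) => τ q.2 q.1)
  continuous : Continuous (fun q : Ω × EuclideanSpace ℝ (Fin d) => τ q.2 q.1)
  ergodic : ∀ f : Ω → ℝ, Measurable f → (∀ y ω, f (τ y ω) = f ω) → ∃ c : ℝ, ∀ᵐ ω ∂P, f ω = c

section Generators

variable {Ω : Type*} [MeasurableSpace Ω] {d : ℕ}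

/-- `f` is in the domain in `L²(Ω)` of the generator `∂ᵢ` of `τ` in the `i`-th coordinate direction,
and `∂ᵢ f = g`: the difference quotients `(f ∘ τ (h eᵢ) - f) / h` converge to `g` in `L²(Ω)`. -/
def HasGenerator (P : Measure Ω) (τ : EuclideanSpace ℝ (Fin d) → Ω → Ω) (i : Fin d)
    (f g : Ω → ℝ) : Prop :=
  MemLp f 2 P ∧ MemLp g 2 P ∧
    Tendsto (fun h : ℝ =>
      eLpNorm (fun ω => (f (τ (h • EuclideanSpace.single i (1 : ℝ)) ω) - f ω) / h - g ω) 2 P)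
      (𝓝[≠] 0) (𝓝 0)

/-- All the successive derivatives of `f` along the directions in the list `l` exist in `L²(Ω)`. -/
def HasIteratedGenerators (P : Measure Ω) (τ : EuclideanSpace ℝ (Fin d) → Ω → Ω) :
    List (Fin d) → (Ω → ℝ) → Prop
  | [], f => MemLp f 2 P
  | i :: l, f => ∃ g : Ω → ℝ, HasGenerator P τ i f g ∧ HasIteratedGenerators P τ l g

/-- The space `𝒟^∞` of bounded functions all of whose iterated derivatives exist in `L²(Ω)`. -/
def IsSmooth (P : Measure Ω) (τ : EuclideanSpace ℝ (Fin d) → Ω → Ω) (f : Ω → ℝ) : Prop :=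
  MemLp f ∞ P ∧ ∀ l : List (Fin d), HasIteratedGenerators P τ l f

/-- The set of `D_ω φ` with `φ ∈ (𝒟^∞)ᵈ`, `div_ω φ = 0`. Here `J i j = ∂ᵢ φⱼ`. -/
def solenoidalSymGradients (P : Measure Ω) (τ : EuclideanSpace ℝ (Fin d) → Ω → Ω) :
    Set (Ω →ₘ[P] SymMat d) :=
  {w | ∃ (φ : Fin d → Ω → ℝ) (J : Fin d → Fin d → Ω → ℝ),
    (∀ j, IsSmooth P τ (φ j)) ∧
    (∀ i j, HasGenerator P τ i (φ j) (J i j)) ∧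
    (∀ᵐ ω ∂P, ∑ i, J i i ω = 0) ∧
    (∀ᵐ ω ∂P, ∀ i j, (w ω).entry i j = (1 / 2) * (J i j ω + J j i ω))}

end Generators

section VariableExponent

variable {Ω : Type*} [MeasurableSpace Ω] {d : ℕ}

/-- The modular `∫ |v(ω)| ^ p(ω) dP(ω)`. -/
def modular (P : Measure Ω) (p : Ω → ℝ) (v : Ω →ₘ[P] SymMat d) : ℝ≥0∞ :=
  ∫⁻ ω, ENNReal.ofReal (‖v ω‖ ^ p ω) ∂P

/-- The variable exponent space `L^{p(·)}(Ω; M)`, of classes of functions modulo a.e. equality. -/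
def variableLp (P : Measure Ω) (p : Ω → ℝ) : Set (Ω →ₘ[P] SymMat d) :=
  {v | modular P p v < ∞}

/-- The Luxemburg norm (infinite if no `r` is admissible). -/
def luxemburgNorm (P : Measure Ω) (p : Ω → ℝ) (v : Ω →ₘ[P] SymMat d) : ℝ≥0∞ :=
  sInf {t | ∃ r : ℝ, 0 < r ∧ modular P p (r⁻¹ • v) ≤ 1 ∧ t = ENNReal.ofReal r}

/-- The space `𝒢(Ω)`: the closure in `L^{p(·)}(Ω; M)`, for the Luxemburg norm, of the set of
symmetrized gradients of divergence free smooth fields. -/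
def cellSpace (P : Measure Ω) (τ : EuclideanSpace ℝ (Fin d) → Ω → Ω) (p : Ω → ℝ) :
    Set (Ω →ₘ[P] SymMat d) :=
  {v | v ∈ variableLp P p ∧ ∀ ε : ℝ≥0∞, 0 < ε →
    ∃ w ∈ solenoidalSymGradients P τ, w ∈ variableLp P p ∧ luxemburgNorm P p (v - w) < ε}

end VariableExponent

end StochasticCell

end

/-! The equation is solved by monotone operator theory (Minty and Browder) in the variable exponent
space, with two shortcuts that avoid duality and weak topologies altogether. Everything is phrased
with the modular `rho u = ∫ ‖u‖ ^ p` on functions; since `1 < α ≤ p ≤ β` almost everywhere, closure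
in the Luxemburg norm is closure in the modular sense (`mem_cellSpace_iff`), and the cell space is a
linear space because the generators of a measure preserving flow are linear.

Weak compactness is replaced by uniform convexity. The powers `‖·‖ ^ p` are uniformly convex,
uniformly in `p ∈ [α, β]` (`norm_sub_rpow_le_defect`, by compactness and homogeneity). Hence
near-minimisers of the modular over a decreasing directed family of bounded closed convex sets form
a Cauchy sequence, and by completeness the family has a common point
(`exists_forall_mem_of_directed`).

Let `K` be the set of `u ∈ ξ + 𝒢` with `rho u ≤ R`. For finitely many `θ ∈ K` there is a convex
combination `u` of them with `∫ A(θ) · (θ - u) ≥ 0` for each: by monotonicity this is a statement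
about matrices with entrywise nonnegative symmetric part, which follows from separation of convex
sets in `ℝⁿ` (`exists_stdSimplex_nonneg`). No fixed point theorem is needed. The previous paragraph
then gives one `u ∈ K` with `∫ A(θ) · (θ - u) ≥ 0` for all `θ ∈ K` (`exists_minty_solution`).
Continuity of `A` along segments turns this into `∫ A(u) · (θ - u) ≥ 0`. Coercivity bounds `rho u`
by a constant independent of `R` (`exists_rho_bound`), so for `R` large `u` is interior to the
constraint and the inequality is an equation on all of `𝒢` (`exists_pairing_eq_zero`). Uniqueness is
strict monotonicity, and integrability is Young's inequality combined with the growth condition. -/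

noncomputable section

namespace StochasticCell

/-! ### Pointwise inequalities for variable powers -/

/-- Young's inequality with a large parameter `T`, uniform in the exponent. -/
lemma mul_le_young_scaled {x y p β T : ℝ} (hx : 0 ≤ x) (hy : 0 ≤ y) (hp : 1 < p) (hpβ : p ≤ β)
    (hT : 1 ≤ T) : x * y ≤ T⁻¹ * x ^ (p / (p - 1)) + T ^ β * y ^ p := by
  have hT0 : 0 < T := by linarith
  have hc : (p / (p - 1)).HolderConjugate p := (Real.HolderConjugate.conjExponent hp).symm
  have h := Real.young_inequality_of_nonneg (a := T⁻¹ * x) (b := T * y)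
    (by positivity) (by positivity) hc
  have hq : 1 < p / (p - 1) := hc.lt
  have e : T⁻¹ * x * (T * y) = x * y := by field_simp
  rw [e, Real.mul_rpow (by positivity) hx, Real.mul_rpow hT0.le hy] at h
  have hxq : 0 ≤ x ^ (p / (p - 1)) := Real.rpow_nonneg hx _
  have hyp : 0 ≤ y ^ p := Real.rpow_nonneg hy _
  have h1 : T⁻¹ ^ (p / (p - 1)) ≤ T⁻¹ := by
    have := Real.rpow_le_rpow_of_exponent_ge (x := T⁻¹) (by positivity) (inv_le_one_of_one_le₀ hT)
      hq.le
    simpa using this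
  have h2 : T ^ p ≤ T ^ β := Real.rpow_le_rpow_of_exponent_le hT hpβ
  refine h.trans (add_le_add ?_ ?_)
  · exact (div_le_self (by positivity) hq.le).trans (by gcongr)
  · exact (div_le_self (by positivity) hp.le).trans (by gcongr)

section Norm

lemma norm_add_rpow_le {E : Type*} [SeminormedAddCommGroup E] {p β : ℝ} (hp : 0 ≤ p)
    (hpβ : p ≤ β) (a b : E) :
    ‖a + b‖ ^ p ≤ 2 ^ β * (‖a‖ ^ p + ‖b‖ ^ p) := by
  have h2 : (2 : ℝ) ^ p ≤ 2 ^ β := Real.rpow_le_rpow_of_exponent_le (by norm_num) hpβ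
  have ha : 0 ≤ ‖a‖ ^ p := by positivity
  have hb : 0 ≤ ‖b‖ ^ p := by positivity
  have h : ‖a + b‖ ≤ 2 * max ‖a‖ ‖b‖ := by
    have := norm_add_le a b
    have := le_max_left ‖a‖ ‖b‖
    have := le_max_right ‖a‖ ‖b‖
    linarith
  calc ‖a + b‖ ^ p ≤ (2 * max ‖a‖ ‖b‖) ^ p := Real.rpow_le_rpow (norm_nonneg _) h hp
    _ = 2 ^ p * (max ‖a‖ ‖b‖) ^ p := Real.mul_rpow (by norm_num) (by positivity)
    _ ≤ 2 ^ β * (‖a‖ ^ p + ‖b‖ ^ p) := by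
      gcongr
      rcases max_choice ‖a‖ ‖b‖ with h | h <;> rw [h] <;> linarith

lemma norm_smul_rpow_le {E : Type*} [SeminormedAddCommGroup E] [NormedSpace ℝ E] {p β c C : ℝ}
    (hp : 0 ≤ p) (hpβ : p ≤ β) (hC : 1 ≤ C) (hc : |c| ≤ C) (a : E) :
    ‖c • a‖ ^ p ≤ C ^ β * ‖a‖ ^ p := by
  have hC0 : 0 ≤ C := by linarith
  rw [norm_smul, Real.norm_eq_abs, Real.mul_rpow (abs_nonneg c) (norm_nonneg a)]
  have : |c| ^ p ≤ C ^ β :=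
    (Real.rpow_le_rpow (abs_nonneg c) hc hp).trans (Real.rpow_le_rpow_of_exponent_le hC hpβ)
  gcongr

variable {E : Type*} [NormedAddCommGroup E] [InnerProductSpace ℝ E]

lemma convexOn_norm_rpow {p : ℝ} (hp : 1 ≤ p) :
    ConvexOn ℝ Set.univ (fun a : E => ‖a‖ ^ p) := by
  refine ⟨convex_univ, fun a _ b _ s t hs ht hst => ?_⟩
  have h1 : ‖s • a + t • b‖ ≤ s * ‖a‖ + t * ‖b‖ := by
    simpa [norm_smul, abs_of_nonneg hs, abs_of_nonneg ht] using norm_add_le (s • a) (t • b)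
  have h2 := (convexOn_rpow hp).2 (norm_nonneg a) (norm_nonneg b) hs ht hst
  exact (Real.rpow_le_rpow (norm_nonneg _) h1 (by linarith)).trans h2

/-- `‖·‖ ^ p` with `p > 1` is strictly convex in an inner product space. -/
lemma eq_of_midpoint_norm_rpow {p : ℝ} (hp : 1 < p) {a b : E}
    (h : (‖a‖ ^ p + ‖b‖ ^ p) / 2 ≤ ‖(1 / 2 : ℝ) • (a + b)‖ ^ p) : a = b := by
  have h0 : ‖(1 / 2 : ℝ) • (a + b)‖ = 1 / 2 * ‖a + b‖ := by
    rw [norm_smul]; norm_num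
  rw [h0] at h
  have htri := norm_add_le a b
  have hn : ‖a‖ = ‖b‖ := by
    by_contra hne
    have h1 := (strictConvexOn_rpow hp).2 (norm_nonneg a) (norm_nonneg b) hne
      (by norm_num : (0 : ℝ) < 1 / 2) (by norm_num : (0 : ℝ) < 1 / 2) (by norm_num)
    simp only [smul_eq_mul] at h1
    have h2 : (1 / 2 * ‖a + b‖) ^ p ≤ (1 / 2 * ‖a‖ + 1 / 2 * ‖b‖) ^ p :=
      Real.rpow_le_rpow (by positivity) (by linarith) (by linarith)
    linarith
  have h3 : ‖a‖ ≤ 1 / 2 * ‖a + b‖ := by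
    rw [← hn, add_self_div_two] at h
    exact (Real.rpow_le_rpow_iff (norm_nonneg _) (by positivity) (by linarith)).1 h
  have h4 : ‖a + b‖ = ‖a‖ + ‖b‖ := by linarith
  exact (sameRay_iff_norm_add.2 h4).eq_of_norm_eq hn

/-- Uniform convexity of `‖·‖ ^ p`, uniformly for `p` in a compact subinterval of `(1, ∞)`:
the convexity defect at the midpoint controls the distance, up to a small relative error. -/
lemma norm_sub_rpow_le_defect [FiniteDimensional ℝ E] {α β ε : ℝ} (hα : 1 < α) (hε : 0 < ε) :
    ∃ K : ℝ, 0 ≤ K ∧ ∀ p, α ≤ p → p ≤ β → ∀ a b : E,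
      ‖a - b‖ ^ p ≤ ε * (‖a‖ ^ p + ‖b‖ ^ p) +
        K * ((‖a‖ ^ p + ‖b‖ ^ p) / 2 - ‖(1 / 2 : ℝ) • (a + b)‖ ^ p) := by
  -- the normalised triples at which the first term on the right does not suffice
  let N : ℝ × E × E → ℝ := fun x => ‖x.2.1‖ ^ x.1 + ‖x.2.2‖ ^ x.1
  let D : ℝ × E × E → ℝ := fun x => N x / 2 - ‖(1 / 2 : ℝ) • (x.2.1 + x.2.2)‖ ^ x.1
  let B : Set (ℝ × E × E) := Set.Icc α β ×ˢ (Metric.closedBall 0 1 : Set (E × E))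
  let S : Set (ℝ × E × E) := B ∩ {x | ‖x.2‖ = 1 ∧ ε * N x ≤ ‖x.2.1 - x.2.2‖ ^ x.1}
  have hB : IsCompact B := isCompact_Icc.prod (isCompact_closedBall _ _)
  have cont : ∀ f : ℝ × E × E → E, Continuous f → ContinuousOn (fun x => ‖f x‖ ^ x.1) B := by
    intro f hf x hx
    exact (ContinuousAt.rpow (hf.norm.continuousAt) continuousAt_fst
      (Or.inr (by linarith [hx.1.1]))).continuousWithinAt
  have hN : ContinuousOn N B := (cont _ (by fun_prop)).add (cont _ (by fun_prop))
  have hD : ContinuousOn D B := (hN.div_const 2).sub (cont _ (by fun_prop))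
  have hS : IsCompact S := by
    refine hB.of_isClosed_subset ?_ Set.inter_subset_left
    have h1 : IsClosed (B ∩ {x | ε * N x ≤ ‖x.2.1 - x.2.2‖ ^ x.1}) :=
      IsClosed.isClosed_le hB.isClosed (continuousOn_const.mul hN) (cont _ (by fun_prop))
    have h2 : IsClosed {x : ℝ × E × E | ‖x.2‖ = 1} := isClosed_eq (by fun_prop) (by fun_prop)
    convert h1.inter h2 using 1
    ext x; simp only [S, Set.mem_inter_iff, Set.mem_ofPred_eq]; tauto
  have hpos : ∀ x ∈ S, 0 < D x := by
    rintro ⟨p, a, b⟩ ⟨⟨⟨hp1, hp2⟩, -⟩, hx1, hx2⟩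
    by_contra hcon
    have hab : a = b := eq_of_midpoint_norm_rpow (p := p) (hα.trans_le hp1)
      (by simpa [D, N] using hcon)
    subst hab
    have ha : ‖a‖ = 1 := by simpa [Prod.norm_def] using hx1
    have hp0 : p ≠ 0 := by simp only at hp1; linarith
    simp [N, ha, Real.zero_rpow hp0] at hx2
    linarith
  obtain ⟨δ, hδ, hδS⟩ : ∃ δ : ℝ, 0 < δ ∧ ∀ x ∈ S, δ ≤ D x := by
    rcases S.eq_empty_or_nonempty with h | h
    · exact ⟨1, one_pos, by simp [h]⟩
    · obtain ⟨x, hx, hmin⟩ := hS.exists_isMinOn h (hD.mono Set.inter_subset_left)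
      exact ⟨D x, hpos x hx, fun y hy => hmin hy⟩
  refine ⟨2 ^ β / δ, by positivity, fun p hp1 hp2 a b => ?_⟩
  have hp : 1 < p := by linarith
  have hDnn : ∀ a b : E, 0 ≤ (‖a‖ ^ p + ‖b‖ ^ p) / 2 - ‖(1 / 2 : ℝ) • (a + b)‖ ^ p := by
    intro a b
    have := (convexOn_norm_rpow (E := E) hp.le).2 (Set.mem_univ a) (Set.mem_univ b)
      (by norm_num : (0 : ℝ) ≤ 1 / 2) (by norm_num : (0 : ℝ) ≤ 1 / 2) (by norm_num)
    simp only [← smul_add, smul_eq_mul] at this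
    linarith
  have key : ∀ a b : E, ‖(a, b)‖ = 1 → ‖a - b‖ ^ p ≤ ε * (‖a‖ ^ p + ‖b‖ ^ p) +
        2 ^ β / δ * ((‖a‖ ^ p + ‖b‖ ^ p) / 2 - ‖(1 / 2 : ℝ) • (a + b)‖ ^ p) := by
    intro a b hab
    by_cases hc : ε * (‖a‖ ^ p + ‖b‖ ^ p) ≤ ‖a - b‖ ^ p
    · have h1 : δ ≤ (‖a‖ ^ p + ‖b‖ ^ p) / 2 - ‖(1 / 2 : ℝ) • (a + b)‖ ^ p :=
        hδS (p, a, b) ⟨⟨⟨hp1, hp2⟩, by simp [hab]⟩, hab, hc⟩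
      have ha : ‖a‖ ≤ 1 := hab ▸ norm_fst_le (a, b)
      have hb : ‖b‖ ≤ 1 := hab ▸ norm_snd_le (a, b)
      have h2 : ‖a - b‖ ^ p ≤ 2 ^ β :=
        (Real.rpow_le_rpow (norm_nonneg _) (by linarith [norm_sub_le a b] : ‖a - b‖ ≤ 2)
          (by linarith)).trans (Real.rpow_le_rpow_of_exponent_le (by norm_num) hp2)
      have h3 : (2 : ℝ) ^ β ≤
          2 ^ β / δ * ((‖a‖ ^ p + ‖b‖ ^ p) / 2 - ‖(1 / 2 : ℝ) • (a + b)‖ ^ p) := by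
        calc (2 : ℝ) ^ β = 2 ^ β / δ * δ := by field_simp
          _ ≤ _ := by gcongr
      have h4 : 0 ≤ ε * (‖a‖ ^ p + ‖b‖ ^ p) := by positivity
      linarith
    · have := mul_nonneg (by positivity : (0 : ℝ) ≤ 2 ^ β / δ) (hDnn a b)
      linarith
  by_cases h0 : (a, b) = 0
  · obtain ⟨rfl, rfl⟩ := Prod.mk_eq_zero.1 h0
    simp [Real.zero_rpow (by linarith : p ≠ 0)]
  -- both sides are positively homogeneous of degree `p`
  set r : ℝ := ‖(a, b)‖ with hr
  have hr0 : 0 < r := norm_pos_iff.2 h0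
  have hk := key (r⁻¹ • a) (r⁻¹ • b) (by
    rw [← Prod.smul_mk, norm_smul, norm_inv, norm_norm, ← hr, inv_mul_cancel₀ hr0.ne'])
  have hs : ∀ c : E, ‖r⁻¹ • c‖ ^ p = (r⁻¹) ^ p * ‖c‖ ^ p := by
    intro c
    rw [norm_smul, Real.norm_of_nonneg (by positivity),
      Real.mul_rpow (by positivity) (by positivity)]
  rw [← smul_sub, ← smul_add, smul_comm, hs, hs, hs, hs] at hk
  have hrp : 0 < (r⁻¹) ^ p := by positivity
  refine le_of_mul_le_mul_left ?_ hrp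
  linarith

end Norm

/-! ### Finite monotone systems -/

/-- A matrix whose symmetric part is entrywise nonnegative admits a mixed strategy with nonnegative
payoffs. This is the finite-dimensional core of the solvability of monotone inequalities. -/
lemma exists_stdSimplex_nonneg {ι : Type*} [Fintype ι] [Nonempty ι] (M : ι → ι → ℝ)
    (hM : ∀ i j, 0 ≤ M i j + M j i) :
    ∃ μ ∈ stdSimplex ℝ ι, ∀ i, 0 ≤ ∑ j, μ j * M i j := by
  classical
  by_contra! hcon
  let L : (ι → ℝ) →ₗ[ℝ] (ι → ℝ) := Matrix.mulVecLin (Matrix.of M)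
  have hL : ∀ μ i, L μ i = ∑ j, μ j * M i j := by
    intro μ i
    simp [L, Matrix.mulVec, dotProduct, mul_comm]
  have hcomp : IsCompact (L '' stdSimplex ℝ ι) :=
    (isCompact_stdSimplex ℝ ι).image (LinearMap.continuous_of_finiteDimensional L)
  have hconv : Convex ℝ (L '' stdSimplex ℝ ι) := (convex_stdSimplex ℝ ι).linear_image L
  have hdisj : Disjoint (L '' stdSimplex ℝ ι) (Set.Ici 0) := by
    rw [Set.disjoint_left]
    rintro _ ⟨μ, hμ, rfl⟩ hx
    obtain ⟨i, hi⟩ := hcon μ hμ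
    have := hx i
    rw [hL] at this
    exact absurd this (not_le.2 hi)
  obtain ⟨f, u, v, hfu, huv, hvf⟩ := geometric_hahn_banach_compact_closed hconv hcomp
    (convex_Ici 0) isClosed_Ici hdisj
  have hf : ∀ x, f x = ∑ i, x i * f (Pi.single i 1) := by
    intro x
    conv_lhs => rw [pi_eq_sum_univ' x]
    simp [map_sum]
  have hv : v < 0 := by simpa using hvf 0 (by simp)
  -- the separating functional is a nonnegative vector `l`; its value at `L l` contradicts `hM`
  let l : ι → ℝ := fun i => f (Pi.single i 1)
  have hl : ∀ i, 0 ≤ l i := by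
    intro i
    by_contra hneg
    push Not at hneg
    have h1 := hvf ((v / l i) • Pi.single i 1) (by
      have : 0 ≤ v / l i := (div_pos_of_neg_of_neg hv hneg).le
      intro j
      by_cases h : j = i
      · subst h; simpa
      · simp [h])
    rw [map_smul, smul_eq_mul] at h1
    change v < v / l i * l i at h1
    rw [div_mul_cancel₀ _ hneg.ne] at h1
    exact lt_irrefl _ h1
  have hsum : 0 < ∑ i, l i := by
    refine (Finset.sum_nonneg fun i _ => hl i).lt_of_ne' fun h => ?_
    have h0 : ∀ i, l i = 0 := fun i =>
      (Finset.sum_eq_zero_iff_of_nonneg fun i _ => hl i).1 h i (Finset.mem_univ i)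
    obtain ⟨μ, hμ⟩ : (stdSimplex ℝ ι).Nonempty :=
      ⟨_, single_mem_stdSimplex ℝ (Classical.arbitrary ι)⟩
    have := hfu _ ⟨μ, hμ, rfl⟩
    rw [hf] at this
    have h0' : ∀ i, f (Pi.single i 1) = 0 := h0
    simp [h0'] at this
    linarith
  have hneg := hfu _ ⟨(∑ i, l i)⁻¹ • l, ⟨fun i => by
    have := hl i
    simp only [Pi.smul_apply, smul_eq_mul]; positivity, by
      simp [← Finset.mul_sum, inv_mul_cancel₀ hsum.ne']⟩, rfl⟩
  rw [map_smul, map_smul, smul_eq_mul, hf] at hneg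
  have hnn : 0 ≤ ∑ i, L l i * f (Pi.single i 1) := by
    have e1 : ∑ i, L l i * f (Pi.single i 1) = ∑ i, ∑ j, l i * l j * M i j := by
      refine Finset.sum_congr rfl fun i _ => ?_
      rw [hL, Finset.sum_mul]
      exact Finset.sum_congr rfl fun j _ => by change l j * M i j * l i = _; ring
    have e2 : ∑ i, ∑ j, l i * l j * M i j = ∑ i, ∑ j, l i * l j * M j i := by
      rw [Finset.sum_comm]
      exact Finset.sum_congr rfl fun i _ => Finset.sum_congr rfl fun j _ => by ring
    have e3 : 0 ≤ ∑ i, ∑ j, l i * l j * (M i j + M j i) :=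
      Finset.sum_nonneg fun i _ => Finset.sum_nonneg fun j _ =>
        mul_nonneg (mul_nonneg (hl i) (hl j)) (hM i j)
    simp only [mul_add, Finset.sum_add_distrib] at e3
    rw [e1]; linarith
  have := mul_nonneg (inv_nonneg.2 hsum.le) hnn
  linarith

/-! ### The modular on functions -/

/-- A measurable exponent with `1 < α ≤ p ≤ β` almost everywhere. -/
structure IsVariableExponent {Ω : Type*} [MeasurableSpace Ω] (P : Measure Ω) (p : Ω → ℝ)
    (α β : ℝ) : Prop where
  measurable : Measurable p
  one_lt : 1 < α
  bounds : ∀ᵐ ω ∂P, α ≤ p ω ∧ p ω ≤ β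

/-- Functions (not classes) with finite modular `∫ ‖u‖ ^ p`. -/
def MemVariableLp {Ω E : Type*} [MeasurableSpace Ω] [NormedAddCommGroup E] (P : Measure Ω)
    (p : Ω → ℝ) (u : Ω → E) : Prop :=
  AEStronglyMeasurable u P ∧ Integrable (fun ω => ‖u ω‖ ^ p ω) P

/-- The modular `∫ ‖u‖ ^ p` as a real number. It is only meaningful under `MemVariableLp`. -/
def rho {Ω E : Type*} [MeasurableSpace Ω] [NormedAddCommGroup E] (P : Measure Ω)
    (p : Ω → ℝ) (u : Ω → E) : ℝ :=
  ∫ ω, ‖u ω‖ ^ p ω ∂P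

section

variable {Ω E : Type*} [MeasurableSpace Ω] [NormedAddCommGroup E]
  {P : Measure Ω} {p : Ω → ℝ} {α β : ℝ}

lemma rho_nonneg (u : Ω → E) : 0 ≤ rho P p u :=
  integral_nonneg fun _ => by positivity

lemma aemeasurable_norm_rpow (hp : Measurable p) {u : Ω → E} (hu : AEStronglyMeasurable u P) :
    AEMeasurable (fun ω => ‖u ω‖ ^ p ω) P :=
  hu.norm.aemeasurable.pow hp.aemeasurable

lemma memVariableLp_iff_lintegral (hp : Measurable p) {u : Ω → E} (hu : AEStronglyMeasurable u P) :
    MemVariableLp P p u ↔ ∫⁻ ω, ENNReal.ofReal (‖u ω‖ ^ p ω) ∂P < ∞ := by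
  have h := hasFiniteIntegral_iff_ofReal (μ := P) (f := fun ω => ‖u ω‖ ^ p ω)
    (Eventually.of_forall fun _ => by positivity)
  rw [← h]
  exact ⟨fun h => h.2.2, fun h => ⟨hu, (aemeasurable_norm_rpow hp hu).aestronglyMeasurable, h⟩⟩

lemma lintegral_norm_rpow_eq {u : Ω → E} (hu : MemVariableLp P p u) :
    ∫⁻ ω, ENNReal.ofReal (‖u ω‖ ^ p ω) ∂P = ENNReal.ofReal (rho P p u) :=
  (ofReal_integral_eq_lintegral_ofReal hu.2 (Eventually.of_forall fun _ => by positivity)).symm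

namespace MemVariableLp

lemma of_bound (hp : IsVariableExponent P p α β) {u : Ω → E} (hu : AEStronglyMeasurable u P)
    {g : Ω → ℝ} (hg : Integrable g P) (h : ∀ᵐ ω ∂P, ‖u ω‖ ^ p ω ≤ g ω) : MemVariableLp P p u := by
  refine ⟨hu, hg.mono' (aemeasurable_norm_rpow hp.measurable hu).aestronglyMeasurable ?_⟩
  filter_upwards [h] with ω hω
  rwa [Real.norm_of_nonneg (by positivity)]

lemma add (hp : IsVariableExponent P p α β) {u v : Ω → E} (hu : MemVariableLp P p u)
    (hv : MemVariableLp P p v) : MemVariableLp P p (u + v) := by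
  refine of_bound hp (hu.1.add hv.1) ((hu.2.add hv.2).const_mul (2 ^ β)) ?_
  filter_upwards [hp.bounds] with ω hω
  exact norm_add_rpow_le (by linarith [hp.one_lt]) hω.2 (u ω) (v ω)

lemma neg {u : Ω → E} (hu : MemVariableLp P p u) : MemVariableLp P p (-u) :=
  ⟨hu.1.neg, by simpa using hu.2⟩

lemma sub (hp : IsVariableExponent P p α β) {u v : Ω → E} (hu : MemVariableLp P p u)
    (hv : MemVariableLp P p v) : MemVariableLp P p (u - v) := by
  rw [sub_eq_add_neg]
  exact hu.add hp hv.neg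

lemma smul [NormedSpace ℝ E] (hp : IsVariableExponent P p α β) (c : ℝ) {u : Ω → E}
    (hu : MemVariableLp P p u) : MemVariableLp P p (c • u) := by
  refine of_bound hp (hu.1.const_smul c) (hu.2.const_mul ((|c| + 1) ^ β)) ?_
  filter_upwards [hp.bounds] with ω hω
  exact norm_smul_rpow_le (by linarith [hp.one_lt]) hω.2 (by linarith [abs_nonneg c])
    (by linarith) (u ω)

lemma const [IsFiniteMeasure P] (hp : IsVariableExponent P p α β) (c : E) :
    MemVariableLp P p (fun _ => c) := by
  refine of_bound hp aestronglyMeasurable_const (integrable_const ((‖c‖ + 1) ^ β)) ?_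
  filter_upwards [hp.bounds] with ω hω
  have h0 : 0 ≤ p ω := by linarith [hp.one_lt]
  exact (Real.rpow_le_rpow (norm_nonneg _) (by linarith : ‖c‖ ≤ ‖c‖ + 1) h0).trans
    (Real.rpow_le_rpow_of_exponent_le (by linarith [norm_nonneg c]) hω.2)

lemma zero (hp : IsVariableExponent P p α β) : MemVariableLp P p (0 : Ω → E) := by
  refine of_bound hp aestronglyMeasurable_zero (integrable_zero _ _ _) ?_
  filter_upwards [hp.bounds] with ω hω
  simp [Real.zero_rpow (by linarith [hp.one_lt] : p ω ≠ 0)]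

end MemVariableLp

lemma rho_smul_le_of_abs_le [NormedSpace ℝ E] (hp : IsVariableExponent P p α β) {c C : ℝ}
    (hC : 1 ≤ C) (hc : |c| ≤ C) {u : Ω → E} (hu : MemVariableLp P p u) :
    rho P p (c • u) ≤ C ^ β * rho P p u := by
  have h := integral_mono_ae (hu.smul hp c).2 (hu.2.const_mul (C ^ β)) (by
    filter_upwards [hp.bounds] with ω hω
    exact norm_smul_rpow_le (by linarith [hp.one_lt]) hω.2 hC hc (u ω))
  rwa [integral_const_mul] at h

lemma rho_smul_le [NormedSpace ℝ E] (hp : IsVariableExponent P p α β) {c : ℝ} (hc : 1 ≤ c)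
    {u : Ω → E} (hu : MemVariableLp P p u) : rho P p (c • u) ≤ c ^ β * rho P p u :=
  rho_smul_le_of_abs_le hp hc (abs_of_nonneg (by linarith)).le hu

lemma rho_zero (hp : IsVariableExponent P p α β) : rho P p (0 : Ω → E) = 0 := by
  refine integral_eq_zero_of_ae ?_
  filter_upwards [hp.bounds] with ω hω
  simp [Real.zero_rpow (by linarith [hp.one_lt] : p ω ≠ 0)]

lemma rho_sub_comm (u v : Ω → E) : rho P p (u - v) = rho P p (v - u) := by
  simp only [rho, Pi.sub_apply, norm_sub_rev]

lemma rho_add_le (hp : IsVariableExponent P p α β) {u v : Ω → E} (hu : MemVariableLp P p u)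
    (hv : MemVariableLp P p v) : rho P p (u + v) ≤ 2 ^ β * (rho P p u + rho P p v) := by
  have h := integral_mono_ae (hu.add hp hv).2 ((hu.2.add hv.2).const_mul (2 ^ β)) (by
    filter_upwards [hp.bounds] with ω hω
    exact norm_add_rpow_le (by linarith [hp.one_lt]) hω.2 (u ω) (v ω))
  rw [integral_const_mul, integral_add' hu.2 hv.2] at h
  exact h

lemma rho_sub_le (hp : IsVariableExponent P p α β) {u v w : Ω → E} (hu : MemVariableLp P p u)
    (hv : MemVariableLp P p v) (hw : MemVariableLp P p w) :
    rho P p (u - w) ≤ 2 ^ β * (rho P p (u - v) + rho P p (v - w)) := by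
  have := rho_add_le hp (hu.sub hp hv) (hv.sub hp hw)
  rwa [sub_add_sub_cancel] at this

lemma integral_norm_le [IsProbabilityMeasure P] (hp : IsVariableExponent P p α β) {u : Ω → E}
    (hu : MemVariableLp P p u) {T : ℝ} (hT : 1 ≤ T) :
    Integrable u P ∧ ∫ ω, ‖u ω‖ ∂P ≤ T⁻¹ + T ^ β * rho P p u := by
  have hb : Integrable (fun ω => T⁻¹ + T ^ β * ‖u ω‖ ^ p ω) P :=
    (integrable_const _).add (hu.2.const_mul _)
  have hle : ∀ᵐ ω ∂P, ‖u ω‖ ≤ T⁻¹ + T ^ β * ‖u ω‖ ^ p ω := by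
    filter_upwards [hp.bounds] with ω hω
    simpa using mul_le_young_scaled zero_le_one (norm_nonneg (u ω))
      (hp.one_lt.trans_le hω.1) hω.2 hT
  have hi : Integrable u P := hb.mono' hu.1 hle
  refine ⟨hi, (integral_mono_ae hi.norm hb hle).trans_eq ?_⟩
  rw [integral_add (integrable_const _) (hu.2.const_mul _), integral_const_mul]
  simp [rho]

/-- Smallness of the modular forces smallness in `L¹`. -/
lemma exists_rho_imp_integral_norm_lt [IsProbabilityMeasure P] (hp : IsVariableExponent P p α β)
    {ε : ℝ} (hε : 0 < ε) : ∃ δ : ℝ, 0 < δ ∧ ∀ u : Ω → E, MemVariableLp P p u → rho P p u < δ →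
      Integrable u P ∧ ∫ ω, ‖u ω‖ ∂P < ε := by
  set T : ℝ := max 1 (2 / ε)
  have hT : 1 ≤ T := le_max_left _ _
  have hT0 : 0 < T := by linarith
  refine ⟨ε / (2 * T ^ β), by positivity, fun u hu h => ?_⟩
  obtain ⟨hi, hle⟩ := integral_norm_le hp hu hT
  refine ⟨hi, hle.trans_lt ?_⟩
  have h1 : T⁻¹ ≤ ε / 2 := by
    rw [inv_le_comm₀ hT0 (by positivity), inv_div]
    exact le_max_right _ _
  have h2 : T ^ β * rho P p u < ε / 2 := by
    calc T ^ β * rho P p u < T ^ β * (ε / (2 * T ^ β)) := by gcongr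
      _ = ε / 2 := by field_simp
  linarith

/-- Completeness: modular Cauchy sequences converge in the modular sense. -/
lemma exists_rho_limit [IsProbabilityMeasure P] [CompleteSpace E]
    (hp : IsVariableExponent P p α β) {u : ℕ → Ω → E} (hu : ∀ n, MemVariableLp P p (u n))
    (hc : ∀ ε : ℝ, 0 < ε → ∃ N, ∀ n m, N ≤ n → N ≤ m → rho P p (u n - u m) < ε) :
    ∃ v : Ω → E, MemVariableLp P p v ∧
      ∀ ε : ℝ, 0 < ε → ∃ N, ∀ n, N ≤ n → rho P p (u n - v) ≤ ε := by
  choose! N hN using hc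
  choose δ hδ hδu using fun k : ℕ =>
    exists_rho_imp_integral_norm_lt (E := E) hp (by positivity : (0 : ℝ) < (1 / 2) ^ k)
  -- a subsequence that is fast Cauchy in `L¹`, hence converges almost everywhere
  let φ : ℕ → ℕ := fun k => k + ∑ j ∈ Finset.range (k + 1), N (δ j)
  have hφN : ∀ j k, j ≤ k → N (δ j) ≤ φ k := by
    intro j k hjk
    have := Finset.single_le_sum (f := fun j => N (δ j)) (fun _ _ => Nat.zero_le _)
      (Finset.mem_range.2 (Nat.lt_succ_of_le hjk))
    exact this.trans (Nat.le_add_left _ _)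
  have hφ : Tendsto φ atTop atTop := tendsto_atTop_mono (fun k => Nat.le_add_right _ _) tendsto_id
  have hae : ∀ᵐ ω ∂P, ∃ l : E, Tendsto (fun k => u (φ k) ω) atTop (𝓝 l) := by
    refine Lp.ae_tendsto_of_cauchy_eLpNorm (p := 1) (fun k => (hu (φ k)).1) le_rfl
      (B := fun k => ENNReal.ofReal ((1 / 2) ^ k)) ?_ ?_
    · rw [← ENNReal.ofReal_tsum_of_nonneg (fun _ => by positivity) summable_geometric_two]
      exact ENNReal.ofReal_ne_top
    · intro k n m hn hm
      obtain ⟨hi, hlt⟩ := hδu k _ ((hu (φ n)).sub hp (hu (φ m)))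
        (hN _ (hδ k) _ _ (hφN k n hn) (hφN k m hm))
      rw [eLpNorm_one_eq_lintegral_enorm, ← ofReal_integral_norm_eq_lintegral_enorm hi]
      exact (ENNReal.ofReal_lt_ofReal_iff (by positivity)).2 hlt
  obtain ⟨v, hvm, hv⟩ := exists_stronglyMeasurable_limit_of_tendsto_ae (fun k => (hu (φ k)).1) hae
  have key : ∀ ε : ℝ, 0 < ε → ∀ n, N ε ≤ n →
      ∫⁻ ω, ENNReal.ofReal (‖(u n - v) ω‖ ^ p ω) ∂P ≤ ENNReal.ofReal ε := by
    intro ε hε n hn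
    have h1 : ∀ᵐ ω ∂P, ENNReal.ofReal (‖(u n - v) ω‖ ^ p ω) =
        liminf (fun k => ENNReal.ofReal (‖(u n - u (φ k)) ω‖ ^ p ω)) atTop := by
      filter_upwards [hv, hp.bounds] with ω hω hpω
      refine (Tendsto.liminf_eq ?_).symm
      have h0 : 0 ≤ p ω := by linarith [hp.one_lt]
      exact ENNReal.tendsto_ofReal (((tendsto_const_nhds.sub hω).norm).rpow_const (Or.inr h0))
    rw [lintegral_congr_ae h1]
    refine (lintegral_liminf_le' fun k => (aemeasurable_norm_rpow hp.measurable
      ((hu n).sub hp (hu (φ k))).1).ennreal_ofReal).trans ?_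
    refine liminf_le_of_frequently_le' (Eventually.frequently ?_)
    filter_upwards [hφ.eventually_ge_atTop (N ε)] with k hk
    rw [lintegral_norm_rpow_eq ((hu n).sub hp (hu (φ k)))]
    exact ENNReal.ofReal_le_ofReal (hN ε hε _ _ hn hk).le
  have hmem : ∀ ε : ℝ, 0 < ε → ∀ n, N ε ≤ n → MemVariableLp P p (u n - v) := fun ε hε n hn =>
    (memVariableLp_iff_lintegral hp.measurable ((hu n).1.sub hvm.aestronglyMeasurable)).2
      ((key ε hε n hn).trans_lt ENNReal.ofReal_lt_top)
  refine ⟨v, ?_, fun ε hε => ⟨N ε, fun n hn => ?_⟩⟩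
  · have := (hu (N 1)).sub hp (hmem 1 one_pos _ le_rfl)
    rwa [sub_sub_cancel] at this
  · have := key ε hε n hn
    rw [lintegral_norm_rpow_eq (hmem ε hε n hn)] at this
    exact (ENNReal.ofReal_le_ofReal_iff hε.le).1 this

end

section Convexity

variable {Ω E : Type*} [MeasurableSpace Ω] [NormedAddCommGroup E] [InnerProductSpace ℝ E]
  {P : Measure Ω} {p : Ω → ℝ} {α β : ℝ}

lemma rho_convex (hp : IsVariableExponent P p α β) {u v : Ω → E} (hu : MemVariableLp P p u)
    (hv : MemVariableLp P p v) {s t : ℝ} (hs : 0 ≤ s) (ht : 0 ≤ t) (hst : s + t = 1) :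
    rho P p (s • u + t • v) ≤ s * rho P p u + t * rho P p v := by
  have h := integral_mono_ae ((hu.smul hp s).add hp (hv.smul hp t)).2
    ((hu.2.const_mul s).add (hv.2.const_mul t)) (by
    filter_upwards [hp.bounds] with ω hω
    exact (convexOn_norm_rpow (by linarith [hp.one_lt])).2 (Set.mem_univ (u ω)) (Set.mem_univ (v ω))
      hs ht hst)
  rw [integral_add' (hu.2.const_mul s) (hv.2.const_mul t), integral_const_mul,
    integral_const_mul] at h
  exact h

/-- Sublevel sets of the modular are closed under modular approximation. -/
lemma rho_le_of_approx (hp : IsVariableExponent P p α β) {u : Ω → E} (hu : MemVariableLp P p u)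
    {R : ℝ} (h : ∀ ε : ℝ, 0 < ε → ∃ w, MemVariableLp P p w ∧ rho P p w ≤ R ∧ rho P p (u - w) < ε) :
    rho P p u ≤ R := by
  -- `u = (1 - t) • w + t • (w + t⁻¹ • (u - w))`, with `u - w` small compared to a power of `t`
  have key : ∀ t : ℝ, 0 < t → t ≤ 1 → rho P p u ≤ R + t * (2 ^ β * (R + 1) - R) := by
    intro t ht0 ht1
    obtain ⟨w, hw, hwR, hlt⟩ := h (((t⁻¹) ^ β)⁻¹) (by positivity)
    have huw := hu.sub hp hw
    have h1 : rho P p (t⁻¹ • (u - w)) ≤ 1 := by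
      refine (rho_smul_le hp ((one_le_inv₀ ht0).2 ht1) huw).trans ?_
      calc (t⁻¹) ^ β * rho P p (u - w) ≤ (t⁻¹) ^ β * ((t⁻¹) ^ β)⁻¹ := by gcongr
        _ = 1 := mul_inv_cancel₀ (by positivity)
    have h2 : (1 - t) • w + t • (w + t⁻¹ • (u - w)) = u := by
      rw [smul_add, smul_inv_smul₀ ht0.ne']
      module
    have h3 := rho_convex hp hw (hw.add hp (huw.smul hp t⁻¹)) (sub_nonneg.2 ht1) ht0.le (by ring)
    rw [h2] at h3
    have h4 : rho P p (w + t⁻¹ • (u - w)) ≤ 2 ^ β * (R + 1) :=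
      (rho_add_le hp hw (huw.smul hp t⁻¹)).trans (by gcongr)
    have h5 : (1 - t) * rho P p w ≤ (1 - t) * R := by
      have := sub_nonneg.2 ht1
      gcongr
    have h6 : t * rho P p (w + t⁻¹ • (u - w)) ≤ t * (2 ^ β * (R + 1)) := by gcongr
    linarith
  have hlim : Tendsto (fun n : ℕ => R + 1 / ((n : ℝ) + 1) * (2 ^ β * (R + 1) - R)) atTop
      (𝓝 (R + 0 * (2 ^ β * (R + 1) - R))) :=
    tendsto_const_nhds.add (tendsto_one_div_add_atTop_nhds_zero_nat.mul tendsto_const_nhds)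
  rw [zero_mul, add_zero] at hlim
  refine ge_of_tendsto' hlim fun n => key _ (by positivity) ?_
  rw [div_le_one (by positivity)]
  linarith [n.cast_nonneg (α := ℝ)]

variable [FiniteDimensional ℝ E]

/-- Uniform convexity of the modular on bounded sets. -/
lemma exists_defect_imp_rho_sub_le (hp : IsVariableExponent P p α β) (R : ℝ) {ε : ℝ} (hε : 0 < ε) :
    ∃ η : ℝ, 0 < η ∧ ∀ u v : Ω → E, MemVariableLp P p u → MemVariableLp P p v →
      rho P p u ≤ R → rho P p v ≤ R →
      (rho P p u + rho P p v) / 2 - rho P p ((1 / 2 : ℝ) • (u + v)) ≤ η →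
      rho P p (u - v) < ε := by
  have hR : 0 < 4 * (|R| + 1) := by positivity
  obtain ⟨K, hK, h⟩ := norm_sub_rpow_le_defect (E := E) (β := β) hp.one_lt (div_pos hε hR)
  refine ⟨ε / (4 * (K + 1)), by positivity, fun u v hu hv huR hvR hd => ?_⟩
  have hm : MemVariableLp P p ((1 / 2 : ℝ) • (u + v)) := (hu.add hp hv).smul hp _
  have hint := integral_mono_ae (hu.sub hp hv).2
    (((hu.2.add hv.2).const_mul (ε / (4 * (|R| + 1)))).add
      ((((hu.2.add hv.2).div_const 2).sub hm.2).const_mul K)) (by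
    filter_upwards [hp.bounds] with ω hω
    exact h (p ω) hω.1 hω.2 (u ω) (v ω))
  rw [integral_add' ((hu.2.add hv.2).const_mul _)
      ((((hu.2.add hv.2).div_const 2).sub hm.2).const_mul K),
    integral_const_mul, integral_const_mul, integral_sub' ((hu.2.add hv.2).div_const 2) hm.2,
    integral_div, integral_add' hu.2 hv.2] at hint
  change rho P p (u - v) ≤ ε / (4 * (|R| + 1)) * (rho P p u + rho P p v) +
    K * ((rho P p u + rho P p v) / 2 - rho P p ((1 / 2 : ℝ) • (u + v))) at hint
  have h1 : ε / (4 * (|R| + 1)) * (rho P p u + rho P p v) ≤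
      ε / (4 * (|R| + 1)) * (2 * (|R| + 1)) := by
    have := le_abs_self R
    gcongr
    linarith
  have h2 : ε / (4 * (|R| + 1)) * (2 * (|R| + 1)) = ε / 2 := by field_simp; norm_num
  have h3 : K * ((rho P p u + rho P p v) / 2 - rho P p ((1 / 2 : ℝ) • (u + v))) ≤
      K * (ε / (4 * (K + 1))) := by gcongr
  have h4 : K * (ε / (4 * (K + 1))) ≤ ε / 4 := by
    rw [← mul_div_assoc, div_le_div_iff₀ (by positivity) (by positivity)]
    nlinarith
  linarith

/-- A directed family of nonempty bounded modular-closed convex sets has a common point. This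
replaces weak compactness of bounded sets: near-minimisers of the modular along the family form
a Cauchy sequence by uniform convexity. -/
lemma exists_forall_mem_of_directed [IsProbabilityMeasure P] (hp : IsVariableExponent P p α β)
    {ι : Type*} (C : Finset ι → Set (Ω → E)) (R : ℝ)
    (hanti : Antitone C) (hne : ∀ F, (C F).Nonempty)
    (hmem : ∀ F, ∀ u ∈ C F, MemVariableLp P p u ∧ rho P p u ≤ R)
    (hmid : ∀ F, ∀ u ∈ C F, ∀ v ∈ C F, (1 / 2 : ℝ) • (u + v) ∈ C F)
    (hclosed : ∀ F u, MemVariableLp P p u →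
      (∀ ε : ℝ, 0 < ε → ∃ w ∈ C F, rho P p (u - w) < ε) → u ∈ C F) :
    ∃ u, ∀ F, u ∈ C F := by
  classical
  let m : Finset ι → ℝ := fun F => sInf (rho P p '' C F)
  have hbdd : ∀ F, BddBelow (rho P p '' C F) := fun F =>
    ⟨0, by rintro _ ⟨u, -, rfl⟩; exact rho_nonneg u⟩
  have hmle : ∀ F, ∀ u ∈ C F, m F ≤ rho P p u := fun F u hu => csInf_le (hbdd F) ⟨u, hu, rfl⟩
  have hmono : Monotone m := fun F F' hF =>
    csInf_le_csInf (hbdd F) ((hne F').image _) (Set.image_mono (hanti hF))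
  have hmR : BddAbove (Set.range m) := by
    refine ⟨R, ?_⟩
    rintro _ ⟨F, rfl⟩
    obtain ⟨u, hu⟩ := hne F
    exact (hmle F u hu).trans (hmem F u hu).2
  set s : ℝ := sSup (Set.range m)
  have hms : ∀ F, m F ≤ s := fun F => le_csSup hmR ⟨F, rfl⟩
  have hF : ∀ n : ℕ, ∃ F, s - 1 / (n + 1) < m F := by
    intro n
    have h0 : (0 : ℝ) < 1 / (n + 1) := by positivity
    obtain ⟨_, ⟨F, rfl⟩, hF⟩ := exists_lt_of_lt_csSup (Set.range_nonempty m)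
      (by linarith : s - 1 / ((n : ℝ) + 1) < s)
    exact ⟨F, hF⟩
  choose F hF using hF
  let G : ℕ → Finset ι := fun n => (Finset.range (n + 1)).biUnion F
  have hGmono : Monotone G := fun a b hab =>
    Finset.biUnion_subset_biUnion_of_subset_left _ (Finset.range_mono (by omega))
  have hG : ∀ n : ℕ, s - 1 / (n + 1) < m (G n) := fun n =>
    (hF n).trans_le (hmono (Finset.subset_biUnion_of_mem F (by simp)))
  have happrox : ∀ (H : Finset ι) (n : ℕ), ∃ u ∈ C H, rho P p u < s + 1 / (n + 1) := by
    intro H n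
    have h0 : (0 : ℝ) < 1 / (n + 1) := by positivity
    obtain ⟨_, ⟨u, hu, rfl⟩, hlt⟩ := exists_lt_of_csInf_lt ((hne H).image (rho P p))
      (show m H < s + 1 / (n + 1) by linarith [hms H])
    exact ⟨u, hu, hlt⟩
  -- near-minimisers over sets far along the family are close to each other
  have hclose : ∀ ε : ℝ, 0 < ε → ∃ N : ℕ, ∀ u ∈ C (G N), ∀ v ∈ C (G N),
      rho P p u < s + 1 / (N + 1) → rho P p v < s + 1 / (N + 1) → rho P p (u - v) < ε := by
    intro ε hε
    obtain ⟨η, hη, h⟩ := exists_defect_imp_rho_sub_le (E := E) hp R hε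
    obtain ⟨N, hN⟩ := exists_nat_one_div_lt (half_pos hη)
    refine ⟨N, fun u hu v hv hus hvs => h u v (hmem _ u hu).1 (hmem _ v hv).1 (hmem _ u hu).2
      (hmem _ v hv).2 ?_⟩
    have := hmle _ _ (hmid _ u hu v hv)
    have := hG N
    linarith
  have hdiv : ∀ {N n : ℕ}, N ≤ n → (1 : ℝ) / (n + 1) ≤ 1 / (N + 1) := fun h =>
    Nat.one_div_le_one_div h
  choose u huC hus using fun n => happrox (G n) n
  have hum : ∀ n, MemVariableLp P p (u n) := fun n => (hmem _ _ (huC n)).1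
  obtain ⟨v, hv, hlim⟩ := exists_rho_limit hp hum (by
    intro ε hε
    obtain ⟨N, hN⟩ := hclose ε hε
    refine ⟨N, fun n k hn hk => hN _ (hanti (hGmono hn) (huC n)) _ (hanti (hGmono hk) (huC k))
      ?_ ?_⟩
    · linarith [hus n, hdiv hn]
    · linarith [hus k, hdiv hk])
  refine ⟨v, fun H => hclosed H v hv fun ε hε => ?_⟩
  have hε' : 0 < ε / (2 * 2 ^ β) / 2 := by positivity
  obtain ⟨N₁, hN₁⟩ := hclose _ hε'
  obtain ⟨N₂, hN₂⟩ := hlim _ hε'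
  set n := max N₁ N₂
  -- a near-minimiser in the smaller set `C (G n ∪ H)` is still close to `u n`, hence to `v`
  obtain ⟨w, hwC, hws⟩ := happrox (G n ∪ H) n
  refine ⟨w, hanti Finset.subset_union_right hwC, ?_⟩
  have hwG : w ∈ C (G n) := hanti Finset.subset_union_left hwC
  have hn1 : N₁ ≤ n := le_max_left _ _
  have h1 := hN₁ (u n) (hanti (hGmono hn1) (huC n)) w (hanti (hGmono hn1) hwG)
    (by linarith [hus n, hdiv hn1]) (by linarith [hdiv hn1])
  have h2 := hN₂ n (le_max_right _ _)
  rw [rho_sub_comm] at h2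
  have h3 := rho_sub_le hp hv (hum n) (hmem _ w hwC).1
  have h4 : (2 : ℝ) ^ β * (rho P p (v - u n) + rho P p (u n - w)) <
      2 ^ β * (2 * (ε / (2 * 2 ^ β) / 2)) := by gcongr; linarith
  have h5 : (2 : ℝ) ^ β * (2 * (ε / (2 * 2 ^ β) / 2)) = ε / 2 := by field_simp
  linarith

end Convexity

/-! ### Monotone fields of variable growth -/

/-- A Carathéodory field, strictly monotone, coercive and of growth `p - 1`. -/
structure IsMonotoneField {Ω E : Type*} [MeasurableSpace Ω] [NormedAddCommGroup E]
    [InnerProductSpace ℝ E] [MeasurableSpace E] (P : Measure Ω) (p : Ω → ℝ) (A : Ω → E → E)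
    (c₀ c₁ : ℝ) : Prop where
  continuous : ∀ᵐ ω ∂P, Continuous (A ω)
  measurable : ∀ ξ, Measurable (fun ω => A ω ξ)
  strictMono : ∀ᵐ ω ∂P, ∀ ξ₁ ξ₂, ξ₁ ≠ ξ₂ → 0 < inner ℝ (A ω ξ₁ - A ω ξ₂) (ξ₁ - ξ₂)
  pos₀ : 0 < c₀
  coercive : ∀ᵐ ω ∂P, ∀ ξ, c₀ * ‖ξ‖ ^ p ω - c₀⁻¹ ≤ inner ℝ (A ω ξ) ξ
  pos₁ : 0 < c₁
  growth : ∀ᵐ ω ∂P, ∀ ξ, ‖A ω ξ‖ ^ (p ω / (p ω - 1)) ≤ c₁ * ‖ξ‖ ^ p ω + c₁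

/-- The pairing `∫ A(ω, u(ω)) · w(ω)`. -/
def pairing {Ω E : Type*} [MeasurableSpace Ω] [NormedAddCommGroup E]
    [InnerProductSpace ℝ E] (P : Measure Ω) (A : Ω → E → E) (u w : Ω → E) : ℝ :=
  ∫ ω, inner ℝ (A ω (u ω)) (w ω) ∂P

/-- A Carathéodory field maps measurable functions to measurable functions; continuity is only
required almost everywhere. -/
lemma aestronglyMeasurable_caratheodory {Ω E F : Type*} [MeasurableSpace Ω] {P : Measure Ω}
    [NormedAddCommGroup E] [SecondCountableTopology E] [MeasurableSpace E] [BorelSpace E]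
    [NormedAddCommGroup F] [SecondCountableTopology F] [MeasurableSpace F] [BorelSpace F]
    {A : Ω → E → F} (hc : ∀ᵐ ω ∂P, Continuous (A ω)) (hm : ∀ ξ, Measurable (fun ω => A ω ξ))
    {u : Ω → E} (hu : AEStronglyMeasurable u P) :
    AEStronglyMeasurable (fun ω => A ω (u ω)) P := by
  classical
  -- `A` is replaced by `0` on a measurable null set, which makes it continuous everywhere
  set N := toMeasurable P {ω | ¬ Continuous (A ω)}
  have hN : MeasurableSet N := measurableSet_toMeasurable _ _
  have hN0 : P N = 0 := by rw [measure_toMeasurable]; exact hc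
  let A' : E → Ω → F := fun ξ ω => if ω ∈ N then 0 else A ω ξ
  have hA' : Measurable (Function.uncurry A') := by
    refine measurable_uncurry_of_continuous_of_measurable (fun ω => ?_) fun ξ =>
      Measurable.ite hN measurable_const (hm ξ)
    by_cases h : ω ∈ N
    · simpa [A', h] using continuous_const
    · have : Continuous (A ω) := by
        by_contra hcon
        exact h (subset_toMeasurable _ _ hcon)
      simpa [A', h] using this
  have h := (hA'.comp_aemeasurable (hu.aemeasurable.prodMk aemeasurable_id)).aestronglyMeasurable
  refine h.congr ?_
  filter_upwards [measure_eq_zero_iff_ae_notMem.1 hN0] with ω hω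
  simp [A', hω]

section

variable {Ω E : Type*} [MeasurableSpace Ω] [NormedAddCommGroup E] [InnerProductSpace ℝ E]
  [FiniteDimensional ℝ E] [MeasurableSpace E] [BorelSpace E]
  {P : Measure Ω} [IsProbabilityMeasure P] {p : Ω → ℝ} {α β c₀ c₁ : ℝ} {A : Ω → E → E}

namespace IsMonotoneField

omit [FiniteDimensional ℝ E] [BorelSpace E] [IsProbabilityMeasure P] in
lemma abs_inner_le (hp : IsVariableExponent P p α β) (hA : IsMonotoneField P p A c₀ c₁)
    {T : ℝ} (hT : 1 ≤ T) : ∀ᵐ ω ∂P, ∀ ξ η : E,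
      |inner ℝ (A ω ξ) η| ≤ T⁻¹ * (c₁ * ‖ξ‖ ^ p ω + c₁) + T ^ β * ‖η‖ ^ p ω := by
  filter_upwards [hA.growth, hp.bounds] with ω hω hpω ξ η
  refine (abs_real_inner_le_norm _ _).trans ((mul_le_young_scaled (norm_nonneg _) (norm_nonneg _)
    (hp.one_lt.trans_le hpω.1) hpω.2 hT).trans ?_)
  have hT0 : 0 < T := by linarith
  have := hω ξ
  gcongr

omit [IsProbabilityMeasure P] in
lemma aestronglyMeasurable_inner (hA : IsMonotoneField P p A c₀ c₁) {u w : Ω → E}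
    (hu : AEStronglyMeasurable u P) (hw : AEStronglyMeasurable w P) :
    AEStronglyMeasurable (fun ω => (inner ℝ (A ω (u ω)) (w ω) : ℝ)) P :=
  haveI : SecondCountableTopology E := 
    haveI := FiniteDimensional.proper ℝ E
    inferInstance
  (aestronglyMeasurable_caratheodory hA.continuous hA.measurable hu).inner hw

lemma integrable (hp : IsVariableExponent P p α β) (hA : IsMonotoneField P p A c₀ c₁)
    {u w : Ω → E} (hu : MemVariableLp P p u) (hw : MemVariableLp P p w) :
    Integrable (fun ω => inner ℝ (A ω (u ω)) (w ω)) P := by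
  refine ((((hu.2.const_mul c₁).add (integrable_const c₁)).const_mul 1⁻¹).add
    (hw.2.const_mul (1 ^ β))).mono' (hA.aestronglyMeasurable_inner hu.1 hw.1) ?_
  filter_upwards [hA.abs_inner_le hp le_rfl] with ω hω
  exact hω (u ω) (w ω)

lemma abs_pairing_le (hp : IsVariableExponent P p α β) (hA : IsMonotoneField P p A c₀ c₁)
    {u w : Ω → E} (hu : MemVariableLp P p u) (hw : MemVariableLp P p w) {T : ℝ} (hT : 1 ≤ T) :
    |pairing P A u w| ≤ T⁻¹ * (c₁ * rho P p u + c₁) + T ^ β * rho P p w := by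
  have h1 : Integrable (fun ω => c₁ * ‖u ω‖ ^ p ω + c₁) P :=
    (hu.2.const_mul c₁).add (integrable_const c₁)
  refine abs_integral_le_integral_abs.trans ((integral_mono_ae (hA.integrable hp hu hw).abs
    ((h1.const_mul T⁻¹).add (hw.2.const_mul (T ^ β))) ?_).trans_eq ?_)
  · filter_upwards [hA.abs_inner_le hp hT] with ω hω
    exact hω (u ω) (w ω)
  · rw [integral_add' (h1.const_mul _) (hw.2.const_mul _), integral_const_mul, integral_const_mul,
      integral_add (hu.2.const_mul c₁) (integrable_const c₁), integral_const_mul]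
    simp [rho]

lemma pairing_add (hp : IsVariableExponent P p α β) (hA : IsMonotoneField P p A c₀ c₁)
    {u v w : Ω → E} (hu : MemVariableLp P p u) (hv : MemVariableLp P p v)
    (hw : MemVariableLp P p w) :
    pairing P A u (v + w) = pairing P A u v + pairing P A u w := by
  simp only [pairing, Pi.add_apply, inner_add_right]
  exact integral_add (hA.integrable hp hu hv) (hA.integrable hp hu hw)

lemma pairing_sub (hp : IsVariableExponent P p α β) (hA : IsMonotoneField P p A c₀ c₁)
    {u v w : Ω → E} (hu : MemVariableLp P p u) (hv : MemVariableLp P p v)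
    (hw : MemVariableLp P p w) :
    pairing P A u (v - w) = pairing P A u v - pairing P A u w := by
  simp only [pairing, Pi.sub_apply, inner_sub_right]
  exact integral_sub (hA.integrable hp hu hv) (hA.integrable hp hu hw)

lemma pairing_sum (hp : IsVariableExponent P p α β) (hA : IsMonotoneField P p A c₀ c₁)
    {ι : Type*} (s : Finset ι) (μ : ι → ℝ) {u : Ω → E} {w : ι → Ω → E} (hu : MemVariableLp P p u)
    (hw : ∀ i, MemVariableLp P p (w i)) :
    pairing P A u (∑ i ∈ s, μ i • w i) = ∑ i ∈ s, μ i * pairing P A u (w i) := by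
  simp only [pairing, Finset.sum_apply, Pi.smul_apply, inner_sum, inner_smul_right]
  rw [integral_finsetSum _ fun i _ => (hA.integrable hp hu (hw i)).const_mul _]
  simp only [integral_const_mul]

omit [FiniteDimensional ℝ E] [BorelSpace E] [IsProbabilityMeasure P] in
lemma inner_sub_nonneg (hA : IsMonotoneField P p A c₀ c₁) :
    ∀ᵐ ω ∂P, ∀ ξ η : E, 0 ≤ (inner ℝ (A ω ξ) (ξ - η) : ℝ) - inner ℝ (A ω η) (ξ - η) := by
  filter_upwards [hA.strictMono] with ω hω ξ η
  rw [← inner_sub_left]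
  by_cases h : ξ = η
  · simp [h]
  · exact (hω ξ η h).le

lemma pairing_mono (hp : IsVariableExponent P p α β) (hA : IsMonotoneField P p A c₀ c₁)
    {u v : Ω → E} (hu : MemVariableLp P p u) (hv : MemVariableLp P p v) :
    pairing P A v (u - v) ≤ pairing P A u (u - v) := by
  refine integral_mono_ae (hA.integrable hp hv (hu.sub hp hv))
    (hA.integrable hp hu (hu.sub hp hv)) ?_
  filter_upwards [hA.inner_sub_nonneg] with ω hω
  exact sub_nonneg.1 (hω (u ω) (v ω))

/-- Strict monotonicity: the pairing separates functions that differ on a set of positive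
measure. -/
lemma ae_eq_of_pairing_eq (hp : IsVariableExponent P p α β) (hA : IsMonotoneField P p A c₀ c₁)
    {u v : Ω → E} (hu : MemVariableLp P p u) (hv : MemVariableLp P p v)
    (h : pairing P A u (u - v) = pairing P A v (u - v)) : u =ᵐ[P] v := by
  have hi := hA.integrable hp hu (hu.sub hp hv)
  have hj := hA.integrable hp hv (hu.sub hp hv)
  have h0 : 0 ≤ᵐ[P] fun ω => (inner ℝ (A ω (u ω)) ((u - v) ω) : ℝ) -
      inner ℝ (A ω (v ω)) ((u - v) ω) := by
    filter_upwards [hA.inner_sub_nonneg] with ω hω using hω (u ω) (v ω)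
  have hz := (integral_eq_zero_iff_of_nonneg_ae h0 (hi.sub hj)).1 (by
    rw [integral_sub hi hj]; exact sub_eq_zero.2 h)
  filter_upwards [hz, hA.strictMono] with ω hω hs
  by_contra hne
  have := hs _ _ hne
  rw [inner_sub_left] at this
  exact this.ne' hω

/-- Continuity along segments, in the form of Minty's trick. -/
lemma pairing_nonneg_of_segment (hp : IsVariableExponent P p α β)
    (hA : IsMonotoneField P p A c₀ c₁) {u v : Ω → E} (hu : MemVariableLp P p u)
    (hv : MemVariableLp P p v)
    (h : ∀ t : ℝ, 0 < t → t ≤ 1 → 0 ≤ pairing P A ((1 - t) • u + t • v) (v - u)) :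
    0 ≤ pairing P A u (v - u) := by
  let t : ℕ → ℝ := fun n => 1 / ((n : ℝ) + 1)
  have ht0 : ∀ n, 0 < t n := fun n => by positivity
  have ht1 : ∀ n, t n ≤ 1 := fun n => by
    rw [div_le_one (by positivity)]; linarith [n.cast_nonneg (α := ℝ)]
  have ht : Tendsto t atTop (𝓝 0) := tendsto_one_div_add_atTop_nhds_zero_nat
  have hw : MemVariableLp P p (v - u) := hv.sub hp hu
  have hut : ∀ n, MemVariableLp P p ((1 - t n) • u + t n • v) := fun n =>
    (hu.smul hp _).add hp (hv.smul hp _)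
  refine ge_of_tendsto' (x := atTop)
    (f := fun n => pairing P A ((1 - t n) • u + t n • v) (v - u)) ?_
    fun n => h _ (ht0 n) (ht1 n)
  refine tendsto_integral_of_dominated_convergence
    (fun ω => 1⁻¹ * (c₁ * (‖u ω‖ ^ p ω + ‖v ω‖ ^ p ω) + c₁) + 1 ^ β * ‖(v - u) ω‖ ^ p ω)
    (fun n => hA.aestronglyMeasurable_inner (hut n).1 hw.1) ?_ (fun n => ?_) ?_
  · exact ((((hu.2.add hv.2).const_mul c₁).add (integrable_const c₁)).const_mul _).add
      (hw.2.const_mul _)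
  · filter_upwards [hA.abs_inner_le hp le_rfl, hp.bounds] with ω hω hpω
    refine (hω _ ((v - u) ω)).trans ?_
    have hc := (convexOn_norm_rpow (E := E) (p := p ω) (by linarith [hp.one_lt])).2
      (Set.mem_univ (u ω)) (Set.mem_univ (v ω)) (sub_nonneg.2 (ht1 n)) (ht0 n).le (by ring)
    have h1 : (1 - t n) • ‖u ω‖ ^ p ω + t n • ‖v ω‖ ^ p ω ≤ ‖u ω‖ ^ p ω + ‖v ω‖ ^ p ω := by
      have h2 : (1 - t n) * ‖u ω‖ ^ p ω ≤ 1 * ‖u ω‖ ^ p ω := by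
        gcongr
        linarith [ht0 n]
      have h3 : t n * ‖v ω‖ ^ p ω ≤ 1 * ‖v ω‖ ^ p ω := by
        gcongr
        exact ht1 n
      simpa only [smul_eq_mul, one_mul] using add_le_add h2 h3
    have hc₁ := hA.pos₁.le
    have h4 := hc.trans h1
    simp only [Pi.add_apply, Pi.smul_apply]
    gcongr
  · filter_upwards [hA.continuous] with ω hω
    have hlim : Tendsto (fun n => (1 - t n) • u ω + t n • v ω) atTop (𝓝 (u ω)) := by
      have := ((tendsto_const_nhds (x := (1 : ℝ))).sub ht).smul_const (u ω)
      simpa using this.add (ht.smul_const (v ω))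
    exact ((hω.tendsto (u ω)).comp hlim).inner tendsto_const_nhds

/-- The a priori bound: coercivity and growth bound the modular of every `u` that satisfies the
equation, or only the inequality, tested with `u - ξ`. -/
lemma exists_rho_bound (hp : IsVariableExponent P p α β) (hA : IsMonotoneField P p A c₀ c₁)
    {ξ : Ω → E} (hξ : MemVariableLp P p ξ) :
    ∃ R : ℝ, ∀ u, MemVariableLp P p u → pairing P A u (u - ξ) ≤ 0 → rho P p u ≤ R := by
  have h₀ := hA.pos₀
  have h₁ := hA.pos₁
  -- `T` is large enough for Young's inequality to absorb the growth term into the coercive one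
  set T : ℝ := max 1 (2 * c₁ / c₀)
  have hT : 1 ≤ T := le_max_left _ _
  have hT0 : 0 < T := by linarith
  have hTc : T⁻¹ * c₁ ≤ c₀ / 2 := by
    have : 2 * c₁ / c₀ ≤ T := le_max_right _ _
    rw [div_le_iff₀ h₀] at this
    rw [inv_mul_le_iff₀ hT0]
    linarith
  refine ⟨2 / c₀ * (c₀⁻¹ + c₀ / 2 + T ^ β * rho P p ξ), fun u hu h => ?_⟩
  rw [hA.pairing_sub hp hu hu hξ] at h
  have h2 : c₀ * rho P p u - c₀⁻¹ ≤ pairing P A u u := by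
    have hi : Integrable (fun ω => c₀ * ‖u ω‖ ^ p ω - c₀⁻¹) P :=
      (hu.2.const_mul c₀).sub (integrable_const _)
    have := integral_mono_ae hi (hA.integrable hp hu hu) (by
      filter_upwards [hA.coercive] with ω hω using hω (u ω))
    rw [integral_sub (hu.2.const_mul c₀) (integrable_const _), integral_const_mul] at this
    simpa [rho, pairing] using this
  have h3 := (le_abs_self _).trans (hA.abs_pairing_le hp hu hξ hT)
  have h4 : T⁻¹ * (c₁ * rho P p u + c₁) ≤ c₀ / 2 * (rho P p u + 1) := by
    calc T⁻¹ * (c₁ * rho P p u + c₁) = T⁻¹ * c₁ * (rho P p u + 1) := by ring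
      _ ≤ _ := by
        have := rho_nonneg (P := P) (p := p) u
        gcongr
  rw [div_mul_eq_mul_div, le_div_iff₀ h₀]
  linarith

/-- Approximation in the modular sense preserves nonnegativity of `w ↦ pairing u (θ - w)`. -/
lemma pairing_sub_nonneg_of_approx (hp : IsVariableExponent P p α β)
    (hA : IsMonotoneField P p A c₀ c₁) {u θ v : Ω → E} (hu : MemVariableLp P p u)
    (hθ : MemVariableLp P p θ) (hv : MemVariableLp P p v)
    (h : ∀ ε : ℝ, 0 < ε → ∃ w, MemVariableLp P p w ∧ 0 ≤ pairing P A u (θ - w) ∧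
      rho P p (v - w) < ε) : 0 ≤ pairing P A u (θ - v) := by
  refine le_of_forall_pos_le_add fun ε hε => ?_
  have h₁ := hA.pos₁
  set M := c₁ * rho P p u + c₁
  have hM : 0 < M := by
    have := rho_nonneg (P := P) (p := p) u
    positivity
  set T : ℝ := max 1 (2 * M / ε)
  have hT : 1 ≤ T := le_max_left _ _
  have hT0 : 0 < T := by linarith
  have hTM : T⁻¹ * M ≤ ε / 2 := by
    have : 2 * M / ε ≤ T := le_max_right _ _
    rw [div_le_iff₀ hε] at this
    rw [inv_mul_le_iff₀ hT0]
    linarith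
  obtain ⟨w, hw, h0, hlt⟩ := h (ε / (2 * T ^ β)) (by positivity)
  have h2 := (le_abs_self _).trans (hA.abs_pairing_le hp hu (hv.sub hp hw) hT)
  have h3 : T ^ β * rho P p (v - w) ≤ ε / 2 := by
    calc T ^ β * rho P p (v - w) ≤ T ^ β * (ε / (2 * T ^ β)) := by gcongr
      _ = ε / 2 := by field_simp
  have h4 : pairing P A u (θ - w) = pairing P A u (θ - v) + pairing P A u (v - w) := by
    rw [← hA.pairing_add hp hu (hθ.sub hp hv) (hv.sub hp hw), sub_add_sub_cancel]
  linarith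

end IsMonotoneField

/-! ### Solvability on closed subspaces -/

/-- Minty's variational inequality on a bounded convex closed set of functions. -/
lemma exists_minty_solution (hp : IsVariableExponent P p α β) (hA : IsMonotoneField P p A c₀ c₁)
    (K : Set (Ω → E)) (R : ℝ) (hKne : K.Nonempty) (hKconv : Convex ℝ K)
    (hKmem : ∀ u ∈ K, MemVariableLp P p u ∧ rho P p u ≤ R)
    (hKclosed : ∀ u, MemVariableLp P p u →
      (∀ ε : ℝ, 0 < ε → ∃ w ∈ K, rho P p (u - w) < ε) → u ∈ K) :
    ∃ u ∈ K, ∀ θ ∈ K, 0 ≤ pairing P A θ (θ - u) := by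
  let C : Finset K → Set (Ω → E) := fun F =>
    {u | u ∈ K ∧ ∀ θ ∈ F, 0 ≤ pairing P A (θ : Ω → E) (θ - u)}
  have hC : ∃ u, ∀ F, u ∈ C F := by
    refine exists_forall_mem_of_directed hp C R
      (fun F F' hF u hu => ⟨hu.1, fun θ hθ => hu.2 θ (hF hθ)⟩) (fun F => ?_)
      (fun F u hu => hKmem u hu.1) (fun F u hu v hv => ⟨?_, fun θ hθ => ?_⟩)
      (fun F u hum h => ⟨hKclosed u hum fun ε hε => ?_, fun θ hθ => ?_⟩)
    · rcases F.eq_empty_or_nonempty with rfl | hF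
      · obtain ⟨u, hu⟩ := hKne
        exact ⟨u, hu, by simp⟩
      have : Nonempty F := hF.coe_sort
      let e : F → Ω → E := fun i => ((i : K) : Ω → E)
      have heK : ∀ i, e i ∈ K := fun i => (i : K).2
      have he : ∀ i, MemVariableLp P p (e i) := fun i => (hKmem _ (heK i)).1
      obtain ⟨μ, ⟨hμ0, hμ1⟩, hμ⟩ := exists_stdSimplex_nonneg
        (fun i j : F => pairing P A (e i) (e i - e j)) (fun i j => by
          have h1 := hA.pairing_mono hp (he i) (he j)
          have h2 : pairing P A (e j) (e j - e i) = - pairing P A (e j) (e i - e j) := by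
            rw [hA.pairing_sub hp (he j) (he j) (he i), hA.pairing_sub hp (he j) (he i) (he j)]
            ring
          linarith)
      refine ⟨∑ j, μ j • e j, hKconv.sum_mem (fun i _ => hμ0 i) hμ1 fun i _ => heK i,
        fun θ hθ => ?_⟩
      have h1 := hμ ⟨θ, hθ⟩
      rw [← hA.pairing_sum hp _ _ (he _) (fun j => (he _).sub hp (he j))] at h1
      have h2 : ∑ j, μ j • (e ⟨θ, hθ⟩ - e j) = (θ : Ω → E) - ∑ j, μ j • e j := by
        simp only [smul_sub, Finset.sum_sub_distrib, ← Finset.sum_smul, hμ1, one_smul]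
        rfl
      rwa [h2] at h1
    · rw [smul_add]
      exact hKconv hu.1 hv.1 (by norm_num) (by norm_num) (by norm_num)
    · have hθm := (hKmem _ θ.2).1
      have hum := (hKmem _ hu.1).1
      have hvm := (hKmem _ hv.1).1
      have h1 := hu.2 θ hθ
      have h2 := hv.2 θ hθ
      have h3 := hA.pairing_sum hp Finset.univ (fun _ : Bool => (1 / 2 : ℝ)) (w := fun b =>
        bif b then (θ : Ω → E) - u else θ - v) hθm (by
          rintro (_ | _)
          · exact hθm.sub hp hvm
          · exact hθm.sub hp hum)
      simp only [Fintype.sum_bool, cond_true, cond_false] at h3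
      have h4 : (1 / 2 : ℝ) • ((θ : Ω → E) - u) + (1 / 2 : ℝ) • ((θ : Ω → E) - v) =
          θ - (1 / 2 : ℝ) • (u + v) := by module
      rw [h4] at h3
      rw [h3]
      linarith
    · obtain ⟨w, hw, hlt⟩ := h ε hε
      exact ⟨w, hw.1, hlt⟩
    · have hθm := (hKmem _ θ.2).1
      refine hA.pairing_sub_nonneg_of_approx hp hθm hθm hum fun ε hε => ?_
      obtain ⟨w, hw, hlt⟩ := h ε hε
      exact ⟨w, (hKmem _ hw.1).1, hw.2 θ hθ, hlt⟩
  obtain ⟨u, hu⟩ := hC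
  exact ⟨u, (hu ∅).1, fun θ hθ => (hu {⟨θ, hθ⟩}).2 ⟨θ, hθ⟩ (Finset.mem_singleton_self _)⟩

/-- The monotone equation is solvable in `ξ + G` for a modular-closed subspace `G`. -/
theorem exists_pairing_eq_zero (hp : IsVariableExponent P p α β)
    (hA : IsMonotoneField P p A c₀ c₁) (G : Submodule ℝ (Ω → E))
    (hG : ∀ u ∈ G, MemVariableLp P p u)
    (hGclosed : ∀ u, MemVariableLp P p u →
      (∀ ε : ℝ, 0 < ε → ∃ w ∈ G, rho P p (u - w) < ε) → u ∈ G)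
    {ξ : Ω → E} (hξ : MemVariableLp P p ξ) :
    ∃ v ∈ G, ∀ θ ∈ G, pairing P A (ξ + v) θ = 0 := by
  obtain ⟨R₀, hR₀⟩ := hA.exists_rho_bound hp hξ
  -- `R` exceeds the a priori bound, so that the constraint `rho ≤ R` is inactive at the solution
  set R := max R₀ (rho P p ξ) + 1
  have hξR : rho P p ξ ≤ R := by linarith [le_max_right R₀ (rho P p ξ)]
  let K : Set (Ω → E) := {u | u - ξ ∈ G ∧ rho P p u ≤ R}
  have hKm : ∀ u ∈ K, MemVariableLp P p u := fun u hu => by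
    have := (hG _ hu.1).add hp hξ
    rwa [sub_add_cancel] at this
  have hKconv : Convex ℝ K := by
    intro u hu v hv s t hs ht hst
    refine ⟨?_, ?_⟩
    · have : s • u + t • v - ξ = s • (u - ξ) + t • (v - ξ) := by
        obtain rfl : s = 1 - t := by linarith
        module
      rw [this]
      exact G.add_mem (G.smul_mem s hu.1) (G.smul_mem t hv.1)
    · refine (rho_convex hp (hKm u hu) (hKm v hv) hs ht hst).trans ?_
      calc s * rho P p u + t * rho P p v ≤ s * R + t * R := by
            have := hu.2
            have := hv.2
            gcongr
        _ = R := by rw [← add_mul, hst, one_mul]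
  obtain ⟨u, huK, hu⟩ := exists_minty_solution hp hA K R ⟨ξ, by simp [K, hξR]⟩ hKconv
    (fun u hu => ⟨hKm u hu, hu.2⟩) (by
      intro u hum h
      refine ⟨hGclosed _ (hum.sub hp hξ) fun ε hε => ?_, ?_⟩
      · obtain ⟨w, hw, hlt⟩ := h ε hε
        exact ⟨w - ξ, hw.1, by rwa [sub_sub_sub_cancel_right]⟩
      · refine rho_le_of_approx hp hum fun ε hε => ?_
        obtain ⟨w, hw, hlt⟩ := h ε hε
        exact ⟨w, hKm w hw, hw.2, hlt⟩)
  have hum := hKm u huK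
  have hvar : ∀ θ ∈ K, 0 ≤ pairing P A u (θ - u) := by
    intro θ hθ
    have hθm := hKm θ hθ
    refine hA.pairing_nonneg_of_segment hp hum hθm fun t ht0 ht1 => ?_
    have h1 := hu _ (hKconv huK hθ (sub_nonneg.2 ht1) ht0.le (by ring))
    have h2 := hA.pairing_sum hp Finset.univ (fun _ : Unit => t) (w := fun _ => θ - u)
      (((hum.smul hp (1 - t))).add hp (hθm.smul hp t)) (fun _ => hθm.sub hp hum)
    simp only [Finset.univ_unique, Finset.sum_singleton] at h2
    have h3 : (1 - t) • u + t • θ - u = t • (θ - u) := by module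
    rw [h3, h2] at h1
    exact nonneg_of_mul_nonneg_right h1 ht0
  have hub : rho P p u ≤ R₀ := by
    refine hR₀ u hum ?_
    have h1 := hvar ξ ⟨by simp, hξR⟩
    rw [hA.pairing_sub hp hum hξ hum] at h1
    rw [hA.pairing_sub hp hum hum hξ]
    linarith
  have huR : rho P p u < R := by linarith [le_max_left R₀ (rho P p ξ)]
  have hnn : ∀ θ ∈ G, 0 ≤ pairing P A u θ := by
    intro θ hθ
    have hθm := hG θ hθ
    have huθ := hum.add hp hθm
    -- a step small enough to stay in the ball
    obtain ⟨t, ht0, ht1, htR⟩ : ∃ t : ℝ, 0 < t ∧ t ≤ 1 ∧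
        (1 - t) * rho P p u + t * rho P p (u + θ) ≤ R := by
      have hb := rho_nonneg (P := P) (p := p) (u + θ)
      have ha := rho_nonneg (P := P) (p := p) u
      refine ⟨min 1 ((R - rho P p u) / (rho P p (u + θ) + 1)), ?_, min_le_left _ _, ?_⟩
      · have : 0 < R - rho P p u := by linarith
        positivity
      · set t := min 1 ((R - rho P p u) / (rho P p (u + θ) + 1))
        have ht : t * (rho P p (u + θ) + 1) ≤ R - rho P p u :=
          (le_div_iff₀ (by positivity)).1 (min_le_right _ _)
        have ht0 : 0 ≤ t := le_min zero_le_one (div_nonneg (by linarith) (by linarith))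
        nlinarith
    have hmem : (1 - t) • u + t • (u + θ) ∈ K := by
      refine ⟨?_, (rho_convex hp hum huθ (sub_nonneg.2 ht1) ht0.le (by ring)).trans htR⟩
      have : (1 - t) • u + t • (u + θ) - ξ = (u - ξ) + t • θ := by module
      rw [this]
      exact G.add_mem huK.1 (G.smul_mem t hθ)
    have h1 := hvar _ hmem
    have h2 := hA.pairing_sum hp Finset.univ (fun _ : Unit => t) (w := fun _ => θ) hum
      (fun _ => hθm)
    simp only [Finset.univ_unique, Finset.sum_singleton] at h2
    have h3 : (1 - t) • u + t • (u + θ) - u = t • θ := by module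
    rw [h3, h2] at h1
    exact nonneg_of_mul_nonneg_right h1 ht0
  refine ⟨u - ξ, huK.1, fun θ hθ => ?_⟩
  rw [add_sub_cancel]
  refine le_antisymm ?_ (hnn θ hθ)
  have h1 := hnn _ (G.neg_mem hθ)
  have h2 := hA.pairing_add hp hum (hG θ hθ) (hG _ (G.neg_mem hθ))
  have h3 : pairing P A u 0 = 0 := by simp [pairing]
  rw [add_neg_cancel, h3] at h2
  linarith

end

/-! ### Linearity of the generators -/

section Generators

variable {Ω : Type*} [MeasurableSpace Ω] {d : ℕ} {P : Measure Ω}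
  {τ : EuclideanSpace ℝ (Fin d) → Ω → Ω}

lemma IsErgodicSystem.measurePreserving [TopologicalSpace Ω] (hτ : IsErgodicSystem P τ)
    (y : EuclideanSpace ℝ (Fin d)) : MeasurePreserving (τ y) P P := by
  have hm : Measurable (τ y) := hτ.measurable.comp (measurable_id.prodMk measurable_const)
  have hinv : ∀ y ω, τ y (τ (-y) ω) = ω := fun y ω => by
    have := congrFun (hτ.add y (-y)) ω
    rw [add_neg_cancel, hτ.zero] at this
    exact this.symm
  refine ⟨hm, Measure.ext fun Q hQ => ?_⟩
  rw [Measure.map_apply hm hQ, ← hτ.measure_image (-y) Q hQ]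
  congr 1
  ext ω
  refine ⟨fun h => ⟨τ y ω, h, by simpa using hinv (-y) ω⟩, ?_⟩
  rintro ⟨ω', h, rfl⟩
  simpa [hinv] using h

variable (hτ : ∀ y, MeasurePreserving (τ y) P P)
include hτ

lemma aestronglyMeasurable_diffQuotient {f g : Ω → ℝ} (hf : AEStronglyMeasurable f P)
    (hg : AEStronglyMeasurable g P) (y : EuclideanSpace ℝ (Fin d)) (h : ℝ) :
    AEStronglyMeasurable (fun ω => (f (τ y ω) - f ω) / h - g ω) P := by
  simp only [div_eq_mul_inv]
  exact (((hf.comp_measurePreserving (hτ y)).sub hf).mul_const h⁻¹).sub hg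

lemma HasGenerator.add {i : Fin d} {f f' g g' : Ω → ℝ} (h : HasGenerator P τ i f g)
    (h' : HasGenerator P τ i f' g') : HasGenerator P τ i (f + f') (g + g') := by
  refine ⟨h.1.add h'.1, h.2.1.add h'.2.1, ?_⟩
  have hlim := h.2.2.add h'.2.2
  rw [add_zero] at hlim
  refine tendsto_of_tendsto_of_tendsto_of_le_of_le tendsto_const_nhds hlim (fun _ => zero_le)
    fun t => ?_
  refine le_trans (le_of_eq ?_) (eLpNorm_add_le
    (aestronglyMeasurable_diffQuotient hτ h.1.1 h.2.1.1 (t • EuclideanSpace.single i (1 : ℝ)) t)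
    (aestronglyMeasurable_diffQuotient hτ h'.1.1 h'.2.1.1 (t • EuclideanSpace.single i (1 : ℝ)) t)
    (by norm_num))
  congr 1
  funext ω
  simp only [Pi.add_apply]
  ring

lemma HasIteratedGenerators.add : ∀ (l : List (Fin d)) {f f' : Ω → ℝ},
    HasIteratedGenerators P τ l f → HasIteratedGenerators P τ l f' →
      HasIteratedGenerators P τ l (f + f')
  | [], _, _, h, h' => MemLp.add h h'
  | _ :: l, _, _, ⟨g, hg, hl⟩, ⟨g', hg', hl'⟩ =>
    ⟨g + g', hg.add hτ hg', HasIteratedGenerators.add l hl hl'⟩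

lemma IsSmooth.add {f f' : Ω → ℝ} (h : IsSmooth P τ f) (h' : IsSmooth P τ f') :
    IsSmooth P τ (f + f') :=
  ⟨h.1.add h'.1, fun l => HasIteratedGenerators.add hτ l (h.2 l) (h'.2 l)⟩

omit hτ

lemma HasGenerator.const_smul {i : Fin d} {f g : Ω → ℝ} (c : ℝ) (h : HasGenerator P τ i f g) :
    HasGenerator P τ i (c • f) (c • g) := by
  refine ⟨h.1.const_smul c, h.2.1.const_smul c, ?_⟩
  have hlim := ENNReal.Tendsto.const_mul (a := ‖c‖ₑ) h.2.2 (Or.inr enorm_ne_top)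
  rw [mul_zero] at hlim
  refine hlim.congr fun t => ?_
  rw [← eLpNorm_const_smul]
  congr 1
  funext ω
  simp only [Pi.smul_apply, smul_eq_mul]
  ring

lemma HasIteratedGenerators.const_smul (c : ℝ) : ∀ (l : List (Fin d)) {f : Ω → ℝ},
    HasIteratedGenerators P τ l f → HasIteratedGenerators P τ l (c • f)
  | [], _, h => MemLp.const_smul h c
  | _ :: l, _, ⟨g, hg, hl⟩ => ⟨c • g, hg.const_smul c, HasIteratedGenerators.const_smul c l hl⟩

lemma IsSmooth.const_smul {f : Ω → ℝ} (c : ℝ) (h : IsSmooth P τ f) : IsSmooth P τ (c • f) :=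
  ⟨h.1.const_smul c, fun l => HasIteratedGenerators.const_smul c l (h.2 l)⟩

lemma HasGenerator.zero (i : Fin d) : HasGenerator P τ i (0 : Ω → ℝ) 0 :=
  ⟨MemLp.zero, MemLp.zero, by simp⟩

lemma HasIteratedGenerators.zero : ∀ l : List (Fin d), HasIteratedGenerators P τ l (0 : Ω → ℝ)
  | [] => MemLp.zero
  | i :: l => ⟨0, HasGenerator.zero i, HasIteratedGenerators.zero l⟩

lemma IsSmooth.zero : IsSmooth P τ (0 : Ω → ℝ) :=
  ⟨MemLp.zero, HasIteratedGenerators.zero⟩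

end Generators

/-! ### The cell space as a modular-closed space of functions -/

section Closure

variable {Ω E : Type*} [MeasurableSpace Ω] [NormedAddCommGroup E]
  {P : Measure Ω} {p : Ω → ℝ} {α β : ℝ}

lemma MemVariableLp.congr {u v : Ω → E} (hu : MemVariableLp P p u) (h : u =ᵐ[P] v) :
    MemVariableLp P p v :=
  ⟨hu.1.congr h, hu.2.congr (h.mono fun ω hω => by simp only [hω])⟩

lemma rho_congr {u v : Ω → E} (h : u =ᵐ[P] v) : rho P p u = rho P p v :=
  integral_congr_ae (h.mono fun ω hω => by simp only [hω])

variable [NormedSpace ℝ E]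

/-- The closure of a linear space of functions under modular approximation. -/
def modularClosure (hp : IsVariableExponent P p α β) (S : Submodule ℝ (Ω → E))
    (hS : ∀ u ∈ S, MemVariableLp P p u) : Submodule ℝ (Ω → E) where
  carrier := {u | MemVariableLp P p u ∧ ∀ ε : ℝ, 0 < ε → ∃ w ∈ S, rho P p (u - w) < ε}
  add_mem' := by
    rintro u v ⟨hu, hu'⟩ ⟨hv, hv'⟩
    refine ⟨hu.add hp hv, fun ε hε => ?_⟩
    obtain ⟨w, hw, h⟩ := hu' (ε / (2 * 2 ^ β)) (by positivity)
    obtain ⟨z, hz, h'⟩ := hv' (ε / (2 * 2 ^ β)) (by positivity)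
    refine ⟨w + z, S.add_mem hw hz, ?_⟩
    rw [add_sub_add_comm]
    calc rho P p (u - w + (v - z)) ≤ 2 ^ β * (rho P p (u - w) + rho P p (v - z)) :=
          rho_add_le hp (hu.sub hp (hS w hw)) (hv.sub hp (hS z hz))
      _ < 2 ^ β * (ε / (2 * 2 ^ β) + ε / (2 * 2 ^ β)) := by gcongr
      _ = ε := by field_simp; norm_num
  zero_mem' := ⟨.zero hp, fun ε hε => ⟨0, S.zero_mem, by rwa [sub_zero, rho_zero hp]⟩⟩
  smul_mem' := by
    rintro c u ⟨hu, hu'⟩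
    refine ⟨hu.smul hp c, fun ε hε => ?_⟩
    obtain ⟨w, hw, h⟩ := hu' (ε / (|c| + 1) ^ β) (by positivity)
    refine ⟨c • w, S.smul_mem c hw, ?_⟩
    rw [← smul_sub]
    calc rho P p (c • (u - w)) ≤ (|c| + 1) ^ β * rho P p (u - w) :=
          rho_smul_le_of_abs_le hp (by linarith [abs_nonneg c]) (by linarith)
            (hu.sub hp (hS w hw))
      _ < (|c| + 1) ^ β * (ε / (|c| + 1) ^ β) := by gcongr
      _ = ε := by field_simp

lemma mem_modularClosure_of_approx (hp : IsVariableExponent P p α β) {S : Submodule ℝ (Ω → E)}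
    (hS : ∀ u ∈ S, MemVariableLp P p u) {u : Ω → E} (hu : MemVariableLp P p u)
    (h : ∀ ε : ℝ, 0 < ε → ∃ w ∈ modularClosure hp S hS, rho P p (u - w) < ε) :
    u ∈ modularClosure hp S hS := by
  refine ⟨hu, fun ε hε => ?_⟩
  obtain ⟨w, hw, h1⟩ := h (ε / (2 * 2 ^ β)) (by positivity)
  obtain ⟨z, hz, h2⟩ := hw.2 (ε / (2 * 2 ^ β)) (by positivity)
  refine ⟨z, hz, ?_⟩
  calc rho P p (u - z) ≤ 2 ^ β * (rho P p (u - w) + rho P p (w - z)) :=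
        rho_sub_le hp hu hw.1 (hS z hz)
    _ < 2 ^ β * (ε / (2 * 2 ^ β) + ε / (2 * 2 ^ β)) := by gcongr
    _ = ε := by field_simp; norm_num

end Closure

section CellSpace

variable {Ω : Type*} [MeasurableSpace Ω] {d : ℕ} {P : Measure Ω}
  {τ : EuclideanSpace ℝ (Fin d) → Ω → Ω} {p : Ω → ℝ} {α β : ℝ}

lemma mem_variableLp_iff (hp : Measurable p) (v : Ω →ₘ[P] SymMat d) :
    v ∈ variableLp P p ↔ MemVariableLp P p v :=
  (memVariableLp_iff_lintegral hp v.aestronglyMeasurable).symm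

lemma modular_le_one_iff {v : Ω →ₘ[P] SymMat d} (hv : MemVariableLp P p v) :
    modular P p v ≤ 1 ↔ rho P p v ≤ 1 := by
  rw [modular, lintegral_norm_rpow_eq hv, ENNReal.ofReal_le_one]

/-- The Luxemburg norm dominates the modular on the unit ball. -/
lemma rho_lt_of_luxemburgNorm_lt (hp : IsVariableExponent P p α β) {v : Ω →ₘ[P] SymMat d}
    {ε : ℝ} (hε1 : ε ≤ 1) (h : luxemburgNorm P p v < ENNReal.ofReal ε) : rho P p v < ε := by
  obtain ⟨_, ⟨r, hr0, hr, rfl⟩, hrε⟩ := sInf_lt_iff.1 h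
  have hrε' : r < ε := by
    by_contra hcon
    exact absurd hrε (not_lt.2 (ENNReal.ofReal_le_ofReal (not_lt.1 hcon)))
  have hm : MemVariableLp P p (r⁻¹ • v : Ω →ₘ[P] SymMat d) :=
    (mem_variableLp_iff hp.measurable _).1 (hr.trans_lt ENNReal.one_lt_top)
  rw [modular_le_one_iff hm] at hr
  have hcoe : (r⁻¹ • v : Ω →ₘ[P] SymMat d) =ᵐ[P] r⁻¹ • v := AEEqFun.coeFn_smul _ _
  -- convexity between `r⁻¹ • v` and `0` gives `rho v ≤ r * rho (r⁻¹ • v) ≤ r`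
  have hc := rho_convex hp (hm.congr hcoe) (MemVariableLp.zero hp) hr0.le
    (by linarith : 0 ≤ 1 - r) (by ring)
  rw [smul_inv_smul₀ hr0.ne', smul_zero, add_zero, rho_zero hp, mul_zero, add_zero,
    ← rho_congr hcoe] at hc
  nlinarith

lemma luxemburgNorm_le_of_rho_le (hp : IsVariableExponent P p α β) {v : Ω →ₘ[P] SymMat d}
    (hv : MemVariableLp P p v) {r : ℝ} (hr0 : 0 < r) (hr1 : r ≤ 1) (h : rho P p v ≤ r ^ β) :
    luxemburgNorm P p v ≤ ENNReal.ofReal r := by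
  have hcoe : (r⁻¹ • v : Ω →ₘ[P] SymMat d) =ᵐ[P] r⁻¹ • v := AEEqFun.coeFn_smul _ _
  refine sInf_le ⟨r, hr0, ?_, rfl⟩
  rw [modular_le_one_iff ((hv.smul hp r⁻¹).congr hcoe.symm), rho_congr hcoe]
  refine (rho_smul_le hp ((one_le_inv₀ hr0).2 hr1) hv).trans ?_
  calc (r⁻¹) ^ β * rho P p v ≤ (r⁻¹) ^ β * r ^ β := by gcongr
    _ = 1 := by
      rw [← Real.mul_rpow (by positivity) hr0.le, inv_mul_cancel₀ hr0.ne', Real.one_rpow]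

/-- Functions of finite modular whose classes are symmetrized gradients of smooth divergence free
fields. -/
def solenoidalFunctions (hp : IsVariableExponent P p α β)
    (hτ : ∀ y, MeasurePreserving (τ y) P P) : Submodule ℝ (Ω → SymMat d) where
  carrier := {w | MemVariableLp P p w ∧ ∃ (φ : Fin d → Ω → ℝ) (J : Fin d → Fin d → Ω → ℝ),
    (∀ j, IsSmooth P τ (φ j)) ∧
    (∀ i j, HasGenerator P τ i (φ j) (J i j)) ∧
    (∀ᵐ ω ∂P, ∑ i, J i i ω = 0) ∧
    (∀ᵐ ω ∂P, ∀ i j, (w ω).entry i j = (1 / 2) * (J i j ω + J j i ω))}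
  add_mem' := by
    rintro w w' ⟨hw, φ, J, h1, h2, h3, h4⟩ ⟨hw', φ', J', h1', h2', h3', h4'⟩
    refine ⟨hw.add hp hw', fun j => φ j + φ' j, fun i j => J i j + J' i j,
      fun j => (h1 j).add hτ (h1' j), fun i j => (h2 i j).add hτ (h2' i j), ?_, ?_⟩
    · filter_upwards [h3, h3'] with ω h h'
      simp [Finset.sum_add_distrib, h, h']
    · filter_upwards [h4, h4'] with ω h h' i j
      have e : ((w + w') ω).entry i j = (w ω).entry i j + (w' ω).entry i j := rfl
      rw [e, h, h']
      simp only [Pi.add_apply]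
      ring
  zero_mem' := by
    refine ⟨.zero hp, fun _ => 0, fun _ _ => 0, fun _ => .zero, fun i _ => .zero i, by simp, ?_⟩
    refine Eventually.of_forall fun ω i j => ?_
    simp [SymMat.entry]
  smul_mem' := by
    rintro c w ⟨hw, φ, J, h1, h2, h3, h4⟩
    refine ⟨hw.smul hp c, fun j => c • φ j, fun i j => c • J i j,
      fun j => (h1 j).const_smul c, fun i j => (h2 i j).const_smul c, ?_, ?_⟩
    · filter_upwards [h3] with ω h
      simp [← Finset.mul_sum, h]
    · filter_upwards [h4] with ω h i j
      have e : ((c • w) ω).entry i j = c * (w ω).entry i j := rfl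
      rw [e, h]
      simp only [Pi.smul_apply, smul_eq_mul]
      ring

/-- The functions whose classes belong to `cellSpace`. -/
def cellFunctions (hp : IsVariableExponent P p α β)
    (hτ : ∀ y, MeasurePreserving (τ y) P P) : Submodule ℝ (Ω → SymMat d) :=
  modularClosure hp (solenoidalFunctions hp hτ) fun _ hu => hu.1

lemma memVariableLp_of_mem_cellFunctions (hp : IsVariableExponent P p α β)
    (hτ : ∀ y, MeasurePreserving (τ y) P P) {u : Ω → SymMat d} (hu : u ∈ cellFunctions hp hτ) :
    MemVariableLp P p u :=
  hu.1

/-- Norm closure and modular closure agree, because the exponent is bounded. -/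
lemma mem_cellSpace_iff (hp : IsVariableExponent P p α β)
    (hτ : ∀ y, MeasurePreserving (τ y) P P) (v : Ω →ₘ[P] SymMat d) :
    v ∈ cellSpace P τ p ↔ (v : Ω → SymMat d) ∈ cellFunctions hp hτ := by
  constructor
  · rintro ⟨hv, h⟩
    refine ⟨(mem_variableLp_iff hp.measurable v).1 hv, fun ε hε => ?_⟩
    obtain ⟨w, hwS, hw, hlt⟩ := h (ENNReal.ofReal (min ε 1)) (ENNReal.ofReal_pos.2 (by positivity))
    refine ⟨w, ⟨(mem_variableLp_iff hp.measurable w).1 hw, hwS⟩, ?_⟩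
    rw [← rho_congr (AEEqFun.coeFn_sub v w)]
    exact (rho_lt_of_luxemburgNorm_lt hp (min_le_right _ _) hlt).trans_le (min_le_left _ _)
  · rintro ⟨hv, h⟩
    refine ⟨(mem_variableLp_iff hp.measurable v).2 hv, fun ε hε => ?_⟩
    obtain ⟨s, hs0, hsε⟩ := ENNReal.lt_iff_exists_nnreal_btwn.1 hε
    have hs0' : 0 < (s : ℝ) := by exact_mod_cast hs0
    set r : ℝ := min s 1
    have hr0 : 0 < r := lt_min hs0' one_pos
    obtain ⟨w, ⟨hw, φ, J, h1, h2, h3, h4⟩, hlt⟩ := h (r ^ β) (by positivity)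
    have hwm : AEEqFun.mk w hw.1 =ᵐ[P] w := AEEqFun.coeFn_mk w hw.1
    have hw' : MemVariableLp P p (AEEqFun.mk w hw.1) := hw.congr hwm.symm
    have hsub : (v - AEEqFun.mk w hw.1 : Ω →ₘ[P] SymMat d) =ᵐ[P] v - w :=
      (AEEqFun.coeFn_sub v _).trans (EventuallyEq.rfl.sub hwm)
    refine ⟨AEEqFun.mk w hw.1, ⟨φ, J, h1, h2, h3, ?_⟩,
      (mem_variableLp_iff hp.measurable _).2 hw', ?_⟩
    · filter_upwards [h4, hwm] with ω h h' i j
      rw [h', h]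
    · refine (luxemburgNorm_le_of_rho_le hp ((hv.sub hp hw).congr hsub.symm) hr0 (min_le_right _ _)
        ?_).trans_lt (lt_of_le_of_lt ?_ hsε)
      · rw [rho_congr hsub]; exact hlt.le
      · rw [← ENNReal.ofReal_coe_nnreal]
        exact ENNReal.ofReal_le_ofReal (min_le_left _ _)

lemma mk_mem_cellSpace (hp : IsVariableExponent P p α β) (hτ : ∀ y, MeasurePreserving (τ y) P P)
    {u : Ω → SymMat d} (hu : u ∈ cellFunctions hp hτ) (hm : AEStronglyMeasurable u P) :
    AEEqFun.mk u hm ∈ cellSpace P τ p := by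
  have h := AEEqFun.coeFn_mk u hm
  refine (mem_cellSpace_iff hp hτ _).2 ⟨hu.1.congr h.symm, fun ε hε => ?_⟩
  obtain ⟨w, hw, hlt⟩ := hu.2 ε hε
  exact ⟨w, hw, by rwa [rho_congr (h.sub EventuallyEq.rfl)]⟩

end CellSpace

end StochasticCell

end

theorem mainTheorem2 {Ω : Type*} [MetricSpace Ω] [CompactSpace Ω] [MeasurableSpace Ω]
    [BorelSpace Ω] (P : Measure Ω) [IsProbabilityMeasure P] (d : ℕ)
    (τ : EuclideanSpace ℝ (Fin d) → Ω → Ω) (hτ : StochasticCell.IsErgodicSystem P τ)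
    (p : Ω → ℝ) (hp : Measurable p) (α β : ℝ) (hα : 1 < α)
    (hpαβ : ∀ᵐ ω ∂P, α ≤ p ω ∧ p ω ≤ β)
    (A : Ω → StochasticCell.SymMat d → StochasticCell.SymMat d)
    (h1_cont : ∀ᵐ ω ∂P, Continuous (A ω))
    (h1_meas : ∀ ξ, Measurable (fun ω => A ω ξ))
    (h2 : ∀ᵐ ω ∂P, ∀ ξ₁ ξ₂, ξ₁ ≠ ξ₂ → 0 < inner ℝ (A ω ξ₁ - A ω ξ₂) (ξ₁ - ξ₂))
    (h3 : ∃ c₀ : ℝ, 0 < c₀ ∧ ∀ᵐ ω ∂P, ∀ ξ, c₀ * ‖ξ‖ ^ p ω - c₀⁻¹ ≤ inner ℝ (A ω ξ) ξ)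
    (h4 : ∃ c₁ : ℝ, 0 < c₁ ∧
      ∀ᵐ ω ∂P, ∀ ξ, ‖A ω ξ‖ ^ (p ω / (p ω - 1)) ≤ c₁ * ‖ξ‖ ^ p ω + c₁)
    (ξ : StochasticCell.SymMat d) :
    (∀ v ∈ StochasticCell.cellSpace P τ p, ∀ θ ∈ StochasticCell.cellSpace P τ p,
      Integrable (fun ω => inner ℝ (A ω (ξ + v ω)) (θ ω)) P) ∧
    ∃! v : Ω →ₘ[P] StochasticCell.SymMat d, v ∈ StochasticCell.cellSpace P τ p ∧
      ∀ θ ∈ StochasticCell.cellSpace P τ p, ∫ ω, inner ℝ (A ω (ξ + v ω)) (θ ω) ∂P = 0 := by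
  obtain ⟨c₀, hc₀, h3⟩ := h3
  obtain ⟨c₁, hc₁, h4⟩ := h4
  have hp' : StochasticCell.IsVariableExponent P p α β := ⟨hp, hα, hpαβ⟩
  have hA : StochasticCell.IsMonotoneField P p A c₀ c₁ :=
    ⟨h1_cont, h1_meas, h2, hc₀, h3, hc₁, h4⟩
  have hτ' := hτ.measurePreserving
  have hξ : StochasticCell.MemVariableLp P p (fun _ : Ω => ξ) := .const hp' ξ
  have hmem := StochasticCell.mem_cellSpace_iff (τ := τ) hp' hτ'
  have hLp : ∀ v ∈ StochasticCell.cellSpace P τ p, StochasticCell.MemVariableLp P p v :=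
    fun v hv => ((hmem v).1 hv).1
  refine ⟨fun v hv θ hθ => hA.integrable hp' (hξ.add hp' (hLp v hv)) (hLp θ hθ), ?_⟩
  obtain ⟨v, hv, hv0⟩ := StochasticCell.exists_pairing_eq_zero hp' hA
    (StochasticCell.cellFunctions hp' hτ') (fun _ hu => hu.1)
    (fun u hu h => StochasticCell.mem_modularClosure_of_approx hp' _ hu h) hξ
  have hLp' {u} := StochasticCell.memVariableLp_of_mem_cellFunctions (u := u) hp' hτ'
  refine ⟨AEEqFun.mk v (hLp' hv).1, ⟨StochasticCell.mk_mem_cellSpace hp' hτ' hv _, fun θ hθ => ?_⟩,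
    fun w hw => ?_⟩
  · refine (integral_congr_ae ?_).trans (hv0 θ ((hmem θ).1 hθ))
    filter_upwards [AEEqFun.coeFn_mk v (hLp' hv).1] with ω hω
    rw [hω]
    rfl
  · -- test both equations with the difference of the two solutions
    have hwG := (hmem w).1 hw.1
    have hdG : (fun _ : Ω => ξ) + (w : Ω → StochasticCell.SymMat d) - ((fun _ : Ω => ξ) + v) ∈
        StochasticCell.cellFunctions hp' hτ' := by
      rw [add_sub_add_left_eq_sub]
      exact Submodule.sub_mem _ hwG hv
    have hd := AEEqFun.coeFn_mk _ (hLp' hdG).1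
    have hw0 : StochasticCell.pairing P A ((fun _ : Ω => ξ) + (w : Ω → StochasticCell.SymMat d))
        ((fun _ : Ω => ξ) + (w : Ω → StochasticCell.SymMat d) - ((fun _ : Ω => ξ) + v)) = 0 := by
      refine (integral_congr_ae ?_).trans
        (hw.2 _ (StochasticCell.mk_mem_cellSpace hp' hτ' hdG (hLp' hdG).1))
      filter_upwards [hd] with ω hω
      rw [hω]
      rfl
    have hae := hA.ae_eq_of_pairing_eq hp' (hξ.add hp' (hLp' hwG)) (hξ.add hp' (hLp' hv))
      (hw0.trans (hv0 _ hdG).symm)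
    refine AEEqFun.ext (EventuallyEq.trans ?_ (AEEqFun.coeFn_mk v (hLp' hv).1).symm)
    filter_upwards [hae] with ω hω
    exact add_left_cancel hω
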